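/- Let $\mathbb Q\langle d,j,y\rangle$ be the noncommutative polynomial ring with $dj=jd=1$; its basis consists of the (reduced) words $j^{k_1}y\,j^{k_2}y\cdots y\,j^{k_r}$ with $r\ge 1$, $k_i\in\mathbb Z$, where $j^{-k}=d^{k}$. Let $\diamond$ be the bilinear product on it given on reduced words, by recursion on their first letters, by $1\diamond w=w\diamond 1=w$ and $$yu\diamond v=u\diamond yv=y(u\diamond v),\quad ju\diamond jv=j(u\diamond jv)+j(ju\diamond v),\quad du\diamond dv=d(u\diamond dv)-u\diamond d^2v,$$ $$du\diamond jv=d(u\diamond jv)-u\diamond v,\quad ju\diamond dv=d(ju\diamond v)-u\diamond v .$$ Let $\mathcal T$ be the span of the words $j^{k_1}y\cdots yj^{k_r}$ with $k_r\ne0$, and let $\mathcal L$ be the two-sided ideal of $(\mathbb Q\langle d,j,y\rangle,\diamond)$ generated by the elements $j^k\{d(u\diamond v)-du\diamond v-u\diamond dv\}$ with $k\in\mathbb Z$ and $u,v$ words ending in $y$. Put $$\mathcal H_-=\mathbb Q\langle d,y\rangle/(\mathcal T_-+\mathcal L_-),\qquad \mathcal T_-=\mathbb Q\langle d,y\rangle\cap\mathcal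 T,\quad \mathcal L_-=\mathbb Q\langle d,y\rangle\cap\mathcal L .$$ Let $\Delta_0$ be the coproduct on $\mathcal H_-$ induced by the homomorphism $\mathbb Q\langle d,y\rangle\to\mathbb Q\langle d,y\rangle^{\otimes 2}$ of concatenation algebras for which $d$ and $y$ are primitive, and let $\varepsilon$ be its counit ($\varepsilon(1)=1$, and $\varepsilon(w)=0$ for every nonempty word $w$). For $\mathbb Q$-linear maps $\alpha,\beta$ from $\mathcal H_-$ to the field $\mathbb Q((z))$ of formal Laurent series let $\alpha*\beta=m\circ(\alpha\otimes\beta)\circ\Delta_0$ be their convolution product. **Theorem.** Let $f(z)=\sum_{n\ge -N}b_nz^n\in\mathbb Q((z))$, let $f_{\ge0}(z)=\sum_{n\ge0}b_nz^n$, and let $\phi:\mathcal H_-\to\mathbb Q((z))$ be the $\mathbb Q$-linear map with $\phi(1)=1$ and $$\phi(d^{k_1}y\cdots d^{k_r}y)=\partial_z^{k_1}\bigl[f\,\partial_z^{k_2}[f\cdots\partial_z^{k_r}[f]\cdots]\bigr]\qquad(r\ge1,\ k_1,\dots,k_r\ge0).$$ There is exactly one pair of $\mathbb Q$-linear maps $\phi_-:\mathcal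 H_-\to\mathbb Q[z^{-1}]$ and $\phi_+:\mathcal H_-\to\mathbb Q[[z]]$ with $\phi_-(1)=1$, $\phi_-(\ker\varepsilon)\subset z^{-1}\mathbb Q[z^{-1}]$ and $\phi=\phi_-^{*-1}*\phi_+$ (the algebraic Birkhoff decomposition of $\phi$). With $$F(k_1,\dots,k_r)=\lim_{z\to0}\phi_+(d^{k_r}y\cdots d^{k_1}y)$$ (the constant coefficient), for every $r\ge1$ one has in $\mathbb Q[[z_1,\dots,z_r]]$ $$\sum_{k_1,\dots,k_r\ge0}\frac{z_1^{k_1}\cdots z_r^{k_r}}{k_1!\cdots k_r!}F(k_1,\dots,k_r)=f_{\ge0}(z_r)\,f_{\ge0}(z_{r-1}+z_r)\cdots f_{\ge0}(z_1+\cdots+z_r).$$ -/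

import Mathlib

namespace ShuffleRenorm

/-- The words in the letters `d, j, y` modulo `dj = jd = 1`.  With `d = j⁻¹`, every such word is
uniquely `j^{k₁} y j^{k₂} y ⋯ y j^{kᵣ}` with `r ≥ 1` and `k₁, …, kᵣ ∈ ℤ`; it is encoded as
`(k₁, [k₂, …, kᵣ])`.  The empty word `1` is `(0, [])`, and the letter `y` occurs as often as
the list is long. -/
abbrev Word : Type := ℤ × List ℤ

namespace Word

/-- The last exponent `kᵣ`. -/
def lastExp (w : Word) : ℤ := w.2.getLastD w.1

/-- `w` contains the letter `y` and its last letter is `y`. -/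
def EndsInY (w : Word) : Prop := w.2 ≠ [] ∧ w.lastExp = 0

/-- A size of words, used only for termination of the recursion defining the product. -/
def weight (w : Word) : ℕ := w.1.natAbs + (w.2.map fun k => k.natAbs + 1).sum

end Word

/-- The vector space underlying `ℚ⟨d, j, y⟩` (with `dj = jd = 1`); words are a basis. -/
abbrev PolyDJY : Type := Word →₀ ℚ

noncomputable section

/-- A word as a basis vector. -/
def word (w : Word) : PolyDJY := Finsupp.single w 1

/-- Left multiplication by `j^n`, for `n ∈ ℤ`. -/
def jPow (n : ℤ) : PolyDJY →ₗ[ℚ] PolyDJY :=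
  Finsupp.lmapDomain ℚ ℚ fun w : Word => ((n + w.1, w.2) : Word)

/-- Left multiplication by `j`. -/
def mulJ : PolyDJY →ₗ[ℚ] PolyDJY := jPow 1
/-- Left multiplication by `d = j⁻¹`. -/
def mulD : PolyDJY →ₗ[ℚ] PolyDJY := jPow (-1)
/-- Left multiplication by `y`. -/
def mulY : PolyDJY →ₗ[ℚ] PolyDJY :=
  Finsupp.lmapDomain ℚ ℚ fun w : Word => ((0, w.1 :: w.2) : Word)

/-- The product `u ⧢₀ v` of two reduced words, by recursion on their first letters:
`1 ⧢₀ w = w ⧢₀ 1 = w`, `yu ⧢₀ v = u ⧢₀ yv = y (u ⧢₀ v)`,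
`ju ⧢₀ jv = j (u ⧢₀ jv) + j (ju ⧢₀ v)`, `ju ⧢₀ dv = d (ju ⧢₀ v) - u ⧢₀ v`,
`du ⧢₀ jv = d (u ⧢₀ jv) - u ⧢₀ v`, `du ⧢₀ dv = d (u ⧢₀ dv) - u ⧢₀ d²v`. -/
def shWord : Word → Word → PolyDJY
  | (a, l), (b, m) =>
    if _ : a = 0 then
      match l with
      | [] => word (b, m)
      | a' :: l' => mulY (shWord (a', l') (b, m))
    else if _ : b = 0 then
      match m with
      | [] => word (a, l)
      | b' :: m' => mulY (shWord (a, l) (b', m'))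
    else if 0 < a then
      if 0 < b then
        mulJ (shWord (a - 1, l) (b, m)) + mulJ (shWord (a, l) (b - 1, m))
      else
        mulD (shWord (a, l) (b + 1, m)) - shWord (a - 1, l) (b + 1, m)
    else
      if 0 < b then
        mulD (shWord (a + 1, l) (b, m)) - shWord (a + 1, l) (b - 1, m)
      else
        mulD (shWord (a + 1, l) (b, m)) - shWord (a + 1, l) (b - 1, m)
  termination_by u v => (u.weight + v.weight, u.weight)
  decreasing_by
    all_goals
      simp only [Word.weight, List.map_cons, List.sum_cons, Prod.lex_def]
      omega

theorem shWord_one_left (v : Word) : shWord (0, []) v = word v := by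
  obtain ⟨b, m⟩ := v
  rw [shWord.eq_def]; simp

theorem shWord_y_left (a : ℤ) (l : List ℤ) (v : Word) :
    shWord (0, a :: l) v = mulY (shWord (a, l) v) := by
  obtain ⟨b, m⟩ := v
  rw [shWord.eq_def]; simp

theorem shWord_one_right (a : ℤ) (l : List ℤ) (ha : a ≠ 0) :
    shWord (a, l) (0, []) = word (a, l) := by
  rw [shWord.eq_def]; simp [ha]

theorem shWord_y_right (a : ℤ) (l : List ℤ) (ha : a ≠ 0) (b : ℤ) (m : List ℤ) :
    shWord (a, l) (0, b :: m) = mulY (shWord (a, l) (b, m)) := by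
  rw [shWord.eq_def]; simp [ha]

theorem shWord_j_j (a : ℤ) (l : List ℤ) (ha : 0 < a) (b : ℤ) (m : List ℤ) (hb : 0 < b) :
    shWord (a, l) (b, m) =
      mulJ (shWord (a - 1, l) (b, m)) + mulJ (shWord (a, l) (b - 1, m)) := by
  rw [shWord.eq_def]; simp [ha, hb, ha.ne', hb.ne']

theorem shWord_j_d (a : ℤ) (l : List ℤ) (ha : 0 < a) (b : ℤ) (m : List ℤ) (hb : b < 0) :
    shWord (a, l) (b, m) =
      mulD (shWord (a, l) (b + 1, m)) - shWord (a - 1, l) (b + 1, m) := by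
  rw [shWord.eq_def]; simp [ha, hb.ne, ha.ne', hb.not_gt]

theorem shWord_d (a : ℤ) (l : List ℤ) (ha : a < 0) (b : ℤ) (m : List ℤ) (hb : b ≠ 0) :
    shWord (a, l) (b, m) =
      mulD (shWord (a + 1, l) (b, m)) - shWord (a + 1, l) (b - 1, m) := by
  rw [shWord.eq_def]; simp [ha.ne, hb, ha.not_gt]


theorem jPow_word (n : ℤ) (w : Word) : jPow n (word w) = word (n + w.1, w.2) := by
  simp [jPow, word]

theorem mulD_word (w : Word) : mulD (word w) = word (-1 + w.1, w.2) := jPow_word _ _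

theorem mulJ_word (w : Word) : mulJ (word w) = word (1 + w.1, w.2) := jPow_word _ _

theorem mulY_word (w : Word) : mulY (word w) = word (0, w.1 :: w.2) := by
  simp [mulY, word]

/-- The product `⧢₀`, bilinearly extended to `ℚ⟨d, j, y⟩`. -/
def sh : PolyDJY →ₗ[ℚ] PolyDJY →ₗ[ℚ] PolyDJY :=
  Finsupp.linearCombination ℚ fun u => Finsupp.linearCombination ℚ (shWord u)

theorem sh_word (u v : Word) : sh (word u) (word v) = shWord u v := by
  simp [sh, word]

/-- Two-sided ideals of the nonassociative algebra `(ℚ⟨d, j, y⟩, ⧢₀)`. -/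
def IsTwoSidedIdeal (I : Submodule ℚ PolyDJY) : Prop :=
  ∀ x ∈ I, ∀ a, sh a x ∈ I ∧ sh x a ∈ I

/-- The elements `j^k {d(u ⧢₀ v) - du ⧢₀ v - u ⧢₀ dv}` with `k ∈ ℤ` and `u, v` words ending
in `y`. -/
def leibnizRelations : Set PolyDJY :=
  {x | ∃ (k : ℤ) (u v : Word), u.EndsInY ∧ v.EndsInY ∧
    x = jPow k (mulD (sh (word u) (word v)) - sh (mulD (word u)) (word v)
      - sh (word u) (mulD (word v)))}

/-- The two-sided ideal `𝓛` generated by the Leibniz relations. -/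
def idealL : Submodule ℚ PolyDJY :=
  sInf {I | IsTwoSidedIdeal I ∧ leibnizRelations ⊆ I}

/-- The subspace `𝓣` spanned by the words `j^{k₁} y ⋯ y j^{kᵣ}` with `kᵣ ≠ 0`. -/
def spaceT : Submodule ℚ PolyDJY :=
  Submodule.span ℚ (word '' {w | w.lastExp ≠ 0})

/-- The two letters of `ℚ⟨d, y⟩`. -/
inductive Letter
  | d
  | y

/-- The noncommutative polynomial ring `ℚ⟨d, y⟩` (with concatenation as product). -/
abbrev PolyDY : Type := FreeAlgebra ℚ Letter

/-- The variable `d`. -/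
def dd : PolyDY := FreeAlgebra.ι ℚ Letter.d
/-- The variable `y`. -/
def yy : PolyDY := FreeAlgebra.ι ℚ Letter.y

/-- Given operators `D` and `Y` on `B`, the action of `ℚ⟨d, y⟩` on `B` in which `d` acts as `D`
and `y` as `Y`. -/
def letterAction {B : Type*} [AddCommGroup B] [Module ℚ B] (D Y : B →ₗ[ℚ] B) :
    PolyDY →ₐ[ℚ] Module.End ℚ B :=
  FreeAlgebra.lift ℚ fun
    | Letter.d => D
    | Letter.y => Y

/-- The inclusion `ℚ⟨d, y⟩ ⊆ ℚ⟨d, j, y⟩`, a word in `d, y` being multiplied out on `1`. -/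
def inclusion : PolyDY →ₗ[ℚ] PolyDJY :=
  LinearMap.applyₗ (word (0, [])) ∘ₗ (letterAction mulD mulY).toLinearMap

/-- `𝓣₋ + 𝓛₋`, where `𝓣₋ = ℚ⟨d, y⟩ ∩ 𝓣` and `𝓛₋ = ℚ⟨d, y⟩ ∩ 𝓛`. -/
def idealTL : Submodule ℚ PolyDY := spaceT.comap inclusion ⊔ idealL.comap inclusion

/-- `𝓗₋ = ℚ⟨d, y⟩ / (𝓣₋ + 𝓛₋)`. -/
abbrev HMinus : Type := PolyDY ⧸ idealTL

section action
variable {B : Type*} [AddCommGroup B] [Module ℚ B] (D Y : B →ₗ[ℚ] B)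

@[simp] theorem letterAction_dd : letterAction D Y dd = D := by simp [letterAction, dd]
@[simp] theorem letterAction_yy : letterAction D Y yy = Y := by simp [letterAction, yy]

theorem PolyDY.induct {C : PolyDY → Prop} (h1 : ∀ c : ℚ, C (algebraMap ℚ PolyDY c))
    (hd : C dd) (hy : C yy) (hm : ∀ a b, C a → C b → C (a * b))
    (ha : ∀ a b, C a → C b → C (a + b)) (p : PolyDY) : C p := by
  induction p using FreeAlgebra.induction with
  | grade0 r => exact h1 r
  | grade1 x => cases x <;> assumption
  | mul a b h1 h2 => exact hm _ _ h1 h2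
  | add a b h1 h2 => exact ha _ _ h1 h2

theorem letterAction_intertwine {B' : Type*} [AddCommGroup B'] [Module ℚ B']
    (D' Y' : B' →ₗ[ℚ] B') (g : B →ₗ[ℚ] B') (hD : ∀ b, g (D b) = D' (g b))
    (hY : ∀ b, g (Y b) = Y' (g b)) (p : PolyDY) :
    ∀ b, g (letterAction D Y p b) = letterAction D' Y' p (g b) := by
  induction p using PolyDY.induct with
  | h1 c => intro b; simp [Module.algebraMap_end_apply]
  | hd => simpa using hD
  | hy => simpa using hY
  | hm a b h1 h2 => intro x; simp [h1, h2]
  | ha a b h1 h2 => intro x; simp [h1, h2]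

theorem letterAction_mem (K : Submodule ℚ B) (hD : ∀ b ∈ K, D b ∈ K)
    (hY : ∀ b ∈ K, Y b ∈ K) (p : PolyDY) : ∀ b ∈ K, letterAction D Y p b ∈ K := by
  induction p using PolyDY.induct with
  | h1 c => intro b hb; simpa [Module.algebraMap_end_apply] using K.smul_mem c hb
  | hd => simpa using hD
  | hy => simpa using hY
  | hm a b h1 h2 => intro x hx; simpa using h1 _ (h2 _ hx)
  | ha a b h1 h2 => intro x hx; simpa using K.add_mem (h1 _ hx) (h2 _ hx)

end action

theorem inclusion_apply (p : PolyDY) :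
    inclusion p = letterAction mulD mulY p (word (0, [])) := rfl

theorem inclusion_mul (p q : PolyDY) :
    inclusion (p * q) = letterAction mulD mulY p (inclusion q) := by
  simp [inclusion_apply]

/-- The linear map on `ℚ⟨d, y⟩` with `1 ↦ 1` and
`d^{k₁} y ⋯ d^{kᵣ} y ↦ D^{k₁}[f D^{k₂}[f ⋯ D^{kᵣ}[f] ⋯ ]]`: the letter `d` acts as `D`, the
letter `y` as multiplication by `f`, and the word is applied to `1`. -/
def iterated {B : Type*} [CommRing B] [Algebra ℚ B] (D : B →ₗ[ℚ] B) (f : B) :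
    PolyDY →ₗ[ℚ] B :=
  LinearMap.applyₗ 1 ∘ₗ (letterAction D (LinearMap.mulLeft ℚ f)).toLinearMap

theorem iterated_apply {B : Type*} [CommRing B] [Algebra ℚ B] (D : B →ₗ[ℚ] B) (f : B)
    (p : PolyDY) : iterated D f p = letterAction D (LinearMap.mulLeft ℚ f) p 1 := rfl

/-! ### Auxiliary facts on the product

The aim of this and the next sections is `idealTL_eq_ker`, which says that `𝓗₋` is the free
differential polynomial ring on one generator; it is what makes the coproduct and the character
below well defined on the quotient `𝓗₋`. -/

theorem span_induct {s : Set Word} (K : Submodule ℚ PolyDJY) (h : ∀ w ∈ s, word w ∈ K)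
    {x : PolyDJY} (hx : x ∈ Submodule.span ℚ (word '' s)) : x ∈ K := by
  refine (Submodule.span_le.2 ?_) hx
  rintro _ ⟨w, hw, rfl⟩
  exact h w hw

theorem word_mem {s : Set Word} {w : Word} (h : w ∈ s) :
    word w ∈ Submodule.span ℚ (word '' s) := Submodule.subset_span ⟨w, h, rfl⟩

theorem span_map {s t : Set Word} (g : PolyDJY →ₗ[ℚ] PolyDJY)
    (h : ∀ w ∈ s, g (word w) ∈ Submodule.span ℚ (word '' t))
    {x : PolyDJY} (hx : x ∈ Submodule.span ℚ (word '' s)) :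
    g x ∈ Submodule.span ℚ (word '' t) :=
  span_induct (Submodule.comap g (Submodule.span ℚ (word '' t))) h hx

theorem span_word_univ : Submodule.span ℚ (word '' Set.univ) = ⊤ := by
  rw [eq_top_iff]
  intro x _
  induction x using Finsupp.induction_linear with
  | zero => exact Submodule.zero_mem _
  | add f g hf hg => exact Submodule.add_mem _ (hf trivial) (hg trivial)
  | single w c =>
    have : (Finsupp.single w c : PolyDJY) = c • word w := by simp [word]
    rw [this]
    exact Submodule.smul_mem _ _ (word_mem trivial)

theorem hom_ext_word {B : Type*} [AddCommGroup B] [Module ℚ B] {g h : PolyDJY →ₗ[ℚ] B}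
    (H : ∀ w, g (word w) = h (word w)) : g = h := by
  apply Finsupp.lhom_ext'
  intro w
  ext
  exact H w

/-- Words that do not begin with `d`. -/
abbrev headNonneg : Set Word := {w | 0 ≤ w.1}
/-- Words in which `y` occurs `n` times. -/
abbrev hasLen (n : ℕ) : Set Word := {w | w.2.length = n}

theorem jPow_hasLen (k : ℤ) (n : ℕ) {x : PolyDJY}
    (hx : x ∈ Submodule.span ℚ (word '' hasLen n)) :
    jPow k x ∈ Submodule.span ℚ (word '' hasLen n) := by
  refine span_map (jPow k) (fun w hw => ?_) hx
  rw [jPow_word]; exact word_mem hw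

theorem mulY_hasLen (n : ℕ) {x : PolyDJY}
    (hx : x ∈ Submodule.span ℚ (word '' hasLen n)) :
    mulY x ∈ Submodule.span ℚ (word '' hasLen (n + 1)) := by
  refine span_map mulY (fun w hw => ?_) hx
  rw [mulY_word]; exact word_mem (by simpa using hw)

theorem shWord_induct (C : Word → Word → Prop)
    (one_left : ∀ v, C (0, []) v)
    (y_left : ∀ a l v, C (a, l) v → C (0, a :: l) v)
    (one_right : ∀ a l, a ≠ 0 → C (a, l) (0, []))
    (y_right : ∀ a l, a ≠ 0 → ∀ b m, C (a, l) (b, m) → C (a, l) (0, b :: m))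
    (j_j : ∀ a l b m, 0 < a → 0 < b → C (a - 1, l) (b, m) → C (a, l) (b - 1, m) →
      C (a, l) (b, m))
    (j_d : ∀ a l b m, 0 < a → b < 0 → C (a, l) (b + 1, m) → C (a - 1, l) (b + 1, m) →
      C (a, l) (b, m))
    (d_ : ∀ a l b m, a < 0 → b ≠ 0 → C (a + 1, l) (b, m) → C (a + 1, l) (b - 1, m) →
      C (a, l) (b, m)) : ∀ u v, C u v
  | (a, l), (b, m) => by
    rcases lt_trichotomy a 0 with ha | rfl | ha
    · by_cases hb : b = 0
      · subst hb
        match m with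
        | [] => exact one_right _ _ ha.ne
        | b' :: m' =>
          exact y_right _ _ ha.ne _ _ (shWord_induct C one_left y_left one_right y_right
            j_j j_d d_ (a, l) (b', m'))
      · exact d_ a l b m ha hb
          (shWord_induct C one_left y_left one_right y_right j_j j_d d_ (a + 1, l) (b, m))
          (shWord_induct C one_left y_left one_right y_right j_j j_d d_ (a + 1, l) (b - 1, m))
    · match l with
      | [] => exact one_left _
      | a' :: l' =>
        exact y_left _ _ _
          (shWord_induct C one_left y_left one_right y_right j_j j_d d_ (a', l') (b, m))
    · rcases lt_trichotomy b 0 with hb | rfl | hb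
      · exact j_d a l b m ha hb
          (shWord_induct C one_left y_left one_right y_right j_j j_d d_ (a, l) (b + 1, m))
          (shWord_induct C one_left y_left one_right y_right j_j j_d d_ (a - 1, l) (b + 1, m))
      · match m with
        | [] => exact one_right _ _ ha.ne'
        | b' :: m' =>
          exact y_right _ _ ha.ne' _ _ (shWord_induct C one_left y_left one_right y_right
            j_j j_d d_ (a, l) (b', m'))
      · exact j_j a l b m ha hb
          (shWord_induct C one_left y_left one_right y_right j_j j_d d_ (a - 1, l) (b, m))
          (shWord_induct C one_left y_left one_right y_right j_j j_d d_ (a, l) (b - 1, m))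
  termination_by u v => (u.weight + v.weight, u.weight)
  decreasing_by
    all_goals
      subst_vars
      simp only [Word.weight, List.map_cons, List.sum_cons, Prod.lex_def]
      omega

theorem shWord_headNonneg (u v : Word) (hu : 0 ≤ u.1) (hv : 0 ≤ v.1) :
    shWord u v ∈ Submodule.span ℚ (word '' headNonneg) := by
  have hY : ∀ x, mulY x ∈ Submodule.span ℚ (word '' headNonneg) := by
    intro x
    have : x ∈ Submodule.span ℚ (word '' Set.univ) := by rw [span_word_univ]; trivial
    refine span_map mulY (fun w _ => ?_) this
    rw [mulY_word]; exact word_mem (le_refl (0 : ℤ))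
  have hJ : ∀ x ∈ Submodule.span ℚ (word '' headNonneg),
      mulJ x ∈ Submodule.span ℚ (word '' headNonneg) := by
    intro x hx
    refine span_map mulJ (fun w hw => ?_) hx
    rw [mulJ_word]; exact word_mem (show (0 : ℤ) ≤ 1 + w.1 from add_nonneg zero_le_one hw)
  refine shWord_induct (fun u v => 0 ≤ u.1 → 0 ≤ v.1 →
    shWord u v ∈ Submodule.span ℚ (word '' headNonneg)) ?_ ?_ ?_ ?_ ?_ ?_ ?_ u v hu hv
  · intro v _ hv; rw [shWord_one_left]; exact word_mem hv
  · intro a l v _ _ _; rw [shWord_y_left]; exact hY _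
  · intro a l ha hu _; rw [shWord_one_right _ _ ha]; exact word_mem hu
  · intro a l ha b m _ _ _; rw [shWord_y_right _ _ ha]; exact hY _
  · intro a l b m ha hb h1 h2 hu hv
    rw [shWord_j_j _ _ ha _ _ hb]
    exact Submodule.add_mem _ (hJ _ (h1 (show 0 ≤ a - 1 by omega) hv))
      (hJ _ (h2 hu (show 0 ≤ b - 1 by omega)))
  · intro a l b m ha hb h1 h2 hu hv
    simp only at hv; omega
  · intro a l b m ha hb h1 h2 hu hv
    simp only at hu; omega

theorem shWord_hasLen (u v : Word) :
    shWord u v ∈ Submodule.span ℚ (word '' hasLen (u.2.length + v.2.length)) := by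
  refine shWord_induct (fun u v =>
    shWord u v ∈ Submodule.span ℚ (word '' hasLen (u.2.length + v.2.length)))
    ?_ ?_ ?_ ?_ ?_ ?_ ?_ u v
  · intro v; rw [shWord_one_left]; exact word_mem (by simp)
  · intro a l v h
    rw [shWord_y_left]
    have := mulY_hasLen _ h
    simp only [List.length_cons] at this ⊢
    convert this using 4; omega
  · intro a l ha; rw [shWord_one_right _ _ ha]; exact word_mem (by simp)
  · intro a l ha b m h
    rw [shWord_y_right _ _ ha]
    exact mulY_hasLen _ h
  · intro a l b m ha hb h1 h2
    rw [shWord_j_j _ _ ha _ _ hb]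
    exact Submodule.add_mem _ (jPow_hasLen _ _ h1) (jPow_hasLen _ _ h2)
  · intro a l b m ha hb h1 h2
    rw [shWord_j_d _ _ ha _ _ hb]
    exact Submodule.sub_mem _ (jPow_hasLen _ _ h1) h2
  · intro a l b m ha hb h1 h2
    rw [shWord_d _ _ ha _ _ hb]
    exact Submodule.sub_mem _ (jPow_hasLen _ _ h1) h2


/-! ### An evaluation of words of `ℚ⟨d, j, y⟩` that kills `𝓛` -/

section psi
variable {B : Type*} [CommRing B] [Algebra ℚ B] (D J : B →ₗ[ℚ] B) (f : B)

/-- The integer powers of `J`, with `D` as `J⁻¹`. -/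
def zAct : ℤ → B → B
  | Int.ofNat n => J^[n]
  | Int.negSucc n => D^[n + 1]

/-- Auxiliary evaluation of the tail of a word. -/
def tailVal : List ℤ → B
  | [] => 1
  | k :: l => f * zAct D J k (tailVal l)

/-- Evaluation of words: `j` acts as `J`, `d` as `D` and `y` as multiplication by `f`. -/
def psi : PolyDJY →ₗ[ℚ] B :=
  Finsupp.linearCombination ℚ fun w : Word => zAct D J w.1 (tailVal D J f w.2)

theorem psi_word (w : Word) : psi D J f (word w) = zAct D J w.1 (tailVal D J f w.2) := by
  simp [psi, word]

theorem zAct_zero (b : B) : zAct D J 0 b = b := rfl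

theorem zAct_succ (k : ℤ) (hk : 0 ≤ k) (b : B) : zAct D J (1 + k) b = J (zAct D J k b) := by
  obtain ⟨n, rfl⟩ := Int.eq_ofNat_of_zero_le hk
  have : (1 + (n : ℤ)) = Int.ofNat (n + 1) := by rw [Int.ofNat_eq_natCast]; push_cast; ring
  rw [this]
  exact Function.iterate_succ_apply' _ _ _

variable {D J}

theorem zAct_pred (hDJ : ∀ b, D (J b) = b) (k : ℤ) (b : B) :
    zAct D J (-1 + k) b = D (zAct D J k b) := by
  match k with
  | Int.ofNat 0 => rfl
  | Int.ofNat (n + 1) =>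
    have : (-1 + Int.ofNat (n + 1)) = Int.ofNat n := by simp
    rw [this]
    change J^[n] b = D (J^[n + 1] b)
    rw [Function.iterate_succ_apply', hDJ]
  | Int.negSucc n =>
    have : (-1 + Int.negSucc n) = Int.negSucc (n + 1) := by
      simp [Int.negSucc_eq]
    rw [this]
    exact Function.iterate_succ_apply' _ _ _

theorem psi_mulD (hDJ : ∀ b, D (J b) = b) (x : PolyDJY) :
    psi D J f (mulD x) = D (psi D J f x) := by
  have : psi D J f ∘ₗ mulD = D ∘ₗ psi D J f := by
    apply hom_ext_word
    intro w
    simp [mulD_word, psi_word, zAct_pred hDJ]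
  exact LinearMap.congr_fun this x

theorem psi_mulY (x : PolyDJY) : psi D J f (mulY x) = f * psi D J f x := by
  have : psi D J f ∘ₗ mulY = LinearMap.mulLeft ℚ f ∘ₗ psi D J f := by
    apply hom_ext_word
    intro w
    simp [mulY_word, psi_word, zAct_zero, tailVal]
  exact LinearMap.congr_fun this x

theorem psi_mulJ {x : PolyDJY} (hx : x ∈ Submodule.span ℚ (word '' headNonneg)) :
    psi D J f (mulJ x) = J (psi D J f x) := by
  have := span_induct (LinearMap.ker (psi D J f ∘ₗ mulJ - J ∘ₗ psi D J f))
    (s := headNonneg) (fun w hw => ?_) hx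
  · simpa [sub_eq_zero] using this
  · simp [mulJ_word, psi_word, zAct_succ D J w.1 hw]

theorem psi_shWord (hDJ : ∀ b, D (J b) = b) (hD : ∀ a b, D (a * b) = D a * b + a * D b)
    (hJ : ∀ a b, J a * J b = J (a * J b) + J (J a * b)) (u v : Word) :
    psi D J f (shWord u v) = psi D J f (word u) * psi D J f (word v) := by
  have hw : ∀ (a : ℤ) (l : List ℤ) (k : ℤ), -1 + k = a →
      psi D J f (word (a, l)) = D (psi D J f (word (k, l))) := by
    rintro _ l k rfl
    simp [psi_word, zAct_pred hDJ]
  have hw' : ∀ (a : ℤ) (l : List ℤ) (k : ℤ), 0 ≤ k → 1 + k = a →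
      psi D J f (word (a, l)) = J (psi D J f (word (k, l))) := by
    rintro _ l k hk rfl
    simp [psi_word, zAct_succ _ _ _ hk]
  have h1 : psi D J f (word (0, [])) = 1 := by simp [psi_word, zAct_zero, tailVal]
  have hy : ∀ (a : ℤ) (l : List ℤ),
      psi D J f (word (0, a :: l)) = f * psi D J f (word (a, l)) := by
    intro a l
    simp [psi_word, zAct_zero, tailVal]
  refine shWord_induct (fun u v => psi D J f (shWord u v) =
    psi D J f (word u) * psi D J f (word v)) ?_ ?_ ?_ ?_ ?_ ?_ ?_ u v
  · intro v; rw [shWord_one_left, h1, one_mul]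
  · intro a l v h; rw [shWord_y_left, psi_mulY, h, hy, mul_assoc]
  · intro a l ha; rw [shWord_one_right _ _ ha, h1, mul_one]
  · intro a l ha b m h; rw [shWord_y_right _ _ ha, psi_mulY, h, hy]; ring
  · intro a l b m ha hb e1 e2
    have n1 := shWord_headNonneg (a - 1, l) (b, m) (by simp; omega) (by simp; omega)
    have n2 := shWord_headNonneg (a, l) (b - 1, m) (by simp; omega) (by simp; omega)
    rw [shWord_j_j _ _ ha _ _ hb, map_add, psi_mulJ f n1, psi_mulJ f n2, e1, e2,
      hw' a l (a - 1) (by omega) (by omega), hw' b m (b - 1) (by omega) (by omega), hJ]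
  · intro a l b m ha hb e1 e2
    rw [shWord_j_d _ _ ha _ _ hb, map_sub, psi_mulD f hDJ, e1, e2, hD,
      hw (a - 1) l a (by omega), hw b m (b + 1) (by omega)]
    ring
  · intro a l b m ha hb e1 e2
    rw [shWord_d _ _ ha _ _ hb, map_sub, psi_mulD f hDJ, e1, e2, hD,
      hw a l (a + 1) (by omega), hw (b - 1) m b (by omega)]
    ring

theorem psi_sh (hDJ : ∀ b, D (J b) = b) (hD : ∀ a b, D (a * b) = D a * b + a * D b)
    (hJ : ∀ a b, J a * J b = J (a * J b) + J (J a * b)) (x y : PolyDJY) :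
    psi D J f (sh x y) = psi D J f x * psi D J f y := by
  have : (sh.compr₂ (psi D J f)) =
      (LinearMap.mul ℚ B).compl₁₂ (psi D J f) (psi D J f) := by
    apply hom_ext_word
    intro u
    apply hom_ext_word
    intro v
    simp [sh_word, psi_shWord f hDJ hD hJ]
  exact LinearMap.congr_fun₂ this x y

theorem psi_len_mem (m : Ideal B) (hDm : ∀ b ∈ m, D b ∈ m) (hJm : ∀ b ∈ m, J b ∈ m)
    (hf : f ∈ m) (n : ℕ) {x : PolyDJY}
    (hx : x ∈ Submodule.span ℚ (word '' hasLen (n + 1))) : psi D J f x ∈ m := by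
  refine span_induct ((m.restrictScalars ℚ).comap (psi D J f)) (fun w hw => ?_) hx
  obtain ⟨k, l⟩ := w
  have key : ∀ k : ℤ, ∀ b ∈ m, zAct D J k b ∈ m := by
    intro k b hb
    match k with
    | Int.ofNat n =>
      change J^[n] b ∈ m
      induction n with
      | zero => exact hb
      | succ n ih => rw [Function.iterate_succ_apply']; exact hJm _ ih
    | Int.negSucc n =>
      change D^[n + 1] b ∈ m
      generalize n + 1 = n
      induction n with
      | zero => exact hb
      | succ n ih => rw [Function.iterate_succ_apply']; exact hDm _ ih
  match l with
  | [] => simp [hasLen] at hw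
  | a :: l =>
    simp only [Submodule.mem_comap, Submodule.restrictScalars_mem, psi_word]
    exact key _ _ (m.mul_mem_right _ hf)

theorem jPow_add (k l : ℤ) (x : PolyDJY) : jPow (k + l) x = jPow k (jPow l x) := by
  have : jPow (k + l) = jPow k ∘ₗ jPow l := by
    apply hom_ext_word
    intro w
    simp [jPow_word, add_assoc]
  exact LinearMap.congr_fun this x

theorem jPow_zero (x : PolyDJY) : jPow 0 x = x := by
  have : jPow 0 = LinearMap.id := by
    apply hom_ext_word
    intro w
    simp [jPow_word]
  exact LinearMap.congr_fun this x

theorem psi_idealL (hDJ : ∀ b, D (J b) = b) (hD : ∀ a b, D (a * b) = D a * b + a * D b)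
    (hJ : ∀ a b, J a * J b = J (a * J b) + J (J a * b))
    (m : Ideal B) (hDm : ∀ b ∈ m, D b ∈ m) (hJm : ∀ b ∈ m, J b ∈ m)
    (hf : f ∈ m) (hinj : ∀ b ∈ m, D b = 0 → b = 0) {x : PolyDJY} (hx : x ∈ idealL) :
    psi D J f x = 0 := by
  have h := (Submodule.mem_sInf.1 hx) (LinearMap.ker (psi D J f)) ⟨?_, ?_⟩
  · exact h
  · intro x hx a
    rw [LinearMap.mem_ker] at hx
    simp [psi_sh f hDJ hD hJ, hx]
  · rintro _ ⟨k, u, v, ⟨hu, -⟩, -, rfl⟩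
    set g := mulD (sh (word u) (word v)) - sh (mulD (word u)) (word v)
      - sh (word u) (mulD (word v)) with hg
    have g0 : psi D J f g = 0 := by
      simp only [hg, map_sub, psi_mulD f hDJ, psi_sh f hDJ hD hJ, hD]
      ring
    have glen : g ∈ Submodule.span ℚ (word '' hasLen (u.2.length + v.2.length)) := by
      refine Submodule.sub_mem _ (Submodule.sub_mem _ ?_ ?_) ?_
      · rw [sh_word]; exact jPow_hasLen _ _ (shWord_hasLen u v)
      · rw [mulD_word, sh_word]; exact shWord_hasLen (-1 + u.1, u.2) v
      · rw [mulD_word, sh_word]; exact shWord_hasLen u (-1 + v.1, v.2)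
    have gm : ∀ k, psi D J f (jPow k g) ∈ m := by
      intro k
      obtain ⟨n, hn⟩ : ∃ n, u.2.length + v.2.length = n + 1 := by
        have := List.length_pos_iff.2 hu
        exact ⟨u.2.length + v.2.length - 1, by omega⟩
      rw [hn] at glen
      exact psi_len_mem f m hDm hJm hf n (jPow_hasLen k _ glen)
    change psi D J f (jPow k g) = 0
    induction k using Int.induction_on with
    | zero => rw [jPow_zero]; exact g0
    | succ k ih =>
      apply hinj _ (gm _)
      rw [← psi_mulD f hDJ, mulD, ← jPow_add]
      have e : (-1 + ((k : ℤ) + 1)) = k := by ring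
      rwa [e]
    | pred k ih =>
      have : (-(k : ℤ) - 1) = -1 + -(k : ℤ) := by ring
      rw [this, jPow_add]
      change psi D J f (mulD _) = 0
      rw [psi_mulD f hDJ, ih, map_zero]

theorem psi_inclusion (hDJ : ∀ b, D (J b) = b) (p : PolyDY) :
    psi D J f (inclusion p) = iterated D f p := by
  rw [inclusion_apply, iterated_apply, letterAction_intertwine mulD mulY D
    (LinearMap.mulLeft ℚ f) (psi D J f) (psi_mulD f hDJ) (psi_mulY f) p]
  simp [psi_word, zAct_zero, tailVal]

/-- The words in `d` and `y` only. -/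
abbrev dyWords : Set Word := {w | w.1 ≤ 0 ∧ ∀ k ∈ w.2, k ≤ 0}

theorem inclusion_mem (p : PolyDY) :
    inclusion p ∈ Submodule.span ℚ (word '' dyWords) := by
  rw [inclusion_apply]
  refine letterAction_mem mulD mulY _ (fun b hb => ?_) (fun b hb => ?_) p _ (word_mem (by simp))
  · refine span_map mulD (fun w hw => ?_) hb
    rw [mulD_word]
    exact word_mem ⟨by have := hw.1; simp; omega, hw.2⟩
  · refine span_map mulY (fun w hw => ?_) hb
    rw [mulY_word]
    exact word_mem ⟨le_rfl, by simpa using hw⟩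

theorem span_word_inter {s t : Set Word} {x : PolyDJY}
    (hs : x ∈ Submodule.span ℚ (word '' s)) (ht : x ∈ Submodule.span ℚ (word '' t)) :
    x ∈ Submodule.span ℚ (word '' (s ∩ t)) := by
  have e : ∀ s : Set Word, Submodule.span ℚ (word '' s) = Finsupp.supported ℚ ℚ s :=
    fun s => (Finsupp.supported_eq_span_single ℚ s).symm
  rw [e] at *
  rw [Finsupp.supported_inter]
  exact ⟨hs, ht⟩

theorem psi_spaceT (hD1 : D 1 = 0) {x : PolyDJY} (hx : x ∈ spaceT)
    (hx' : x ∈ Submodule.span ℚ (word '' dyWords)) : psi D J f x = 0 := by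
  refine span_induct (LinearMap.ker (psi D J f)) (fun w hw => ?_) (span_word_inter hx hx')
  obtain ⟨k, l⟩ := w
  obtain ⟨hT, hk, hl⟩ := hw
  have hit : ∀ n, D^[n + 1] 1 = 0 := by
    intro n
    induction n with
    | zero => simpa using hD1
    | succ n ih => rw [Function.iterate_succ_apply', ih, map_zero]
  have hz : ∀ k, zAct D J k 0 = 0 := by
    intro k
    match k with
    | Int.ofNat n => exact Function.iterate_fixed (map_zero J) n
    | Int.negSucc n => exact Function.iterate_fixed (map_zero D) _
  rw [LinearMap.mem_ker, psi_word]
  simp only at hk hl ⊢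
  induction l generalizing k with
  | nil =>
    simp only [Word.lastExp, Set.mem_ofPred_eq, List.getLastD_nil] at hT
    match k, hk, hT with
    | Int.negSucc n, _, _ => exact hit n
    | Int.ofNat n, hk, hT => simp at hk hT; omega
  | cons a l ih =>
    have e : Word.lastExp (k, a :: l) = Word.lastExp (a, l) := by
      simp only [Word.lastExp, List.getLastD_cons]
    have := ih a (show Word.lastExp (a, l) ≠ 0 from e ▸ hT)
      (hl a (by simp)) (fun b hb => hl b (by simp [hb]))
    rw [tailVal, this, mul_zero, hz]

theorem iterated_idealTL (hDJ : ∀ b, D (J b) = b) (hD : ∀ a b, D (a * b) = D a * b + a * D b)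
    (hJ : ∀ a b, J a * J b = J (a * J b) + J (J a * b))
    (m : Ideal B) (hDm : ∀ b ∈ m, D b ∈ m) (hJm : ∀ b ∈ m, J b ∈ m)
    (hf : f ∈ m) (hinj : ∀ b ∈ m, D b = 0 → b = 0) {p : PolyDY} (hp : p ∈ idealTL) :
    iterated D f p = 0 := by
  have hD1 : D 1 = 0 := by simpa using hD 1 1
  obtain ⟨a, ha, b, hb, rfl⟩ := Submodule.mem_sup.1 hp
  rw [map_add, ← psi_inclusion f hDJ, ← psi_inclusion f hDJ,
    psi_spaceT f hD1 ha (inclusion_mem a), psi_idealL f hDJ hD hJ m hDm hJm hf hinj hb, add_zero]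

end psi

/-! ### The free differential polynomial ring -/

/-- The free differential polynomial ring on one generator `X 0`, with `X n` its `n`-th
derivative. -/
abbrev DiffPoly : Type := MvPolynomial ℕ ℚ

/-- Its derivation. -/
def dX : Derivation ℚ DiffPoly DiffPoly :=
  MvPolynomial.mkDerivation ℚ fun n => MvPolynomial.X (n + 1)

theorem dX_X (n : ℕ) : dX (MvPolynomial.X n) = MvPolynomial.X (n + 1) := by simp [dX]

/-- The iterated-differential map for the generic element `X 0`. -/
def toDiffPoly : PolyDY →ₗ[ℚ] DiffPoly := iterated dX.toLinearMap (MvPolynomial.X 0)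

theorem toDiffPoly_apply (p : PolyDY) :
    toDiffPoly p = letterAction dX.toLinearMap (LinearMap.mulLeft ℚ (MvPolynomial.X 0)) p 1 := rfl

theorem iterated_eq_aeval {B : Type*} [CommRing B] [Algebra ℚ B] (D : B →ₗ[ℚ] B) (f : B)
    (hD : ∀ a b, D (a * b) = D a * b + a * D b) (p : PolyDY) :
    iterated D f p = MvPolynomial.aeval (fun n => D^[n] f) (toDiffPoly p) := by
  have hD1 : D 1 = 0 := by simpa using hD 1 1
  have hDc : ∀ c : ℚ, D (algebraMap ℚ B c) = 0 := by
    intro c; rw [Algebra.algebraMap_eq_smul_one, map_smul, hD1, smul_zero]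
  rw [toDiffPoly_apply]
  have := letterAction_intertwine dX.toLinearMap (LinearMap.mulLeft ℚ (MvPolynomial.X 0)) D
    (LinearMap.mulLeft ℚ f)
    (MvPolynomial.aeval (fun n => D^[n] f) : DiffPoly →ₐ[ℚ] B).toLinearMap
    (fun q => ?_) (fun q => ?_) p 1
  · simp only [AlgHom.toLinearMap_apply, map_one] at this
    rw [this, iterated_apply]
  · change MvPolynomial.aeval (fun n => D^[n] f) (dX q) = D (MvPolynomial.aeval (fun n => D^[n] f) q)
    induction q using MvPolynomial.induction_on with
    | C c => simp [← MvPolynomial.algebraMap_eq, hDc]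
    | add p q hp hq => simp [hp, hq]
    | mul_X p n hp =>
      rw [Derivation.leibniz, dX_X, map_mul, hD, ← hp]
      simp only [smul_eq_mul, map_add, map_mul, MvPolynomial.aeval_X,
        Function.iterate_succ_apply']
      ring
  · simp

section model
open Polynomial

/-- A right inverse of `w + d/dX` on polynomials. -/
theorem exists_rightInverse (w : ℚ) : ∃ K : ℚ[X] →ₗ[ℚ] ℚ[X],
    (∀ p, w • K p + derivative (K p) = p) ∧ (w = 0 → ∀ p, (K p).eval 0 = 0) := by
  have h : ∀ n : ℕ, ∃ q : ℚ[X], w • q + derivative q = X ^ n ∧ (w = 0 → q.eval 0 = 0) := by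
    intro n
    by_cases hw : w = 0
    · refine ⟨((n : ℚ) + 1)⁻¹ • X ^ (n + 1), ?_, ?_⟩
      · have : (n : ℚ) + 1 ≠ 0 := by positivity
        rw [hw, zero_smul, zero_add, derivative_smul, derivative_X_pow, add_tsub_cancel_right,
          ← smul_eq_C_mul, smul_smul]
        push_cast
        rw [inv_mul_cancel₀ this, one_smul]
      · intro _; simp
    · induction n with
      | zero => exact ⟨C w⁻¹, by simp [smul_C, hw], fun h => absurd h hw⟩
      | succ n ih =>
        obtain ⟨q, hq, -⟩ := ih
        refine ⟨w⁻¹ • (X ^ (n + 1) - ((n : ℚ) + 1) • q), ?_, fun h => absurd h hw⟩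
        rw [smul_smul, mul_inv_cancel₀ hw, one_smul, derivative_smul, derivative_sub,
          derivative_smul, derivative_X_pow, add_tsub_cancel_right, ← hq, ← smul_eq_C_mul]
        push_cast
        have : ((n : ℚ) + 1) • (w • q + derivative q) - ((n : ℚ) + 1) • derivative q
          = w • ((n : ℚ) + 1) • q := by module
        rw [this, smul_smul w⁻¹, inv_mul_cancel₀ hw, one_smul, sub_add_cancel]
  choose q hq1 hq2 using h
  refine ⟨(basisMonomials ℚ).constr ℚ q, ?_, ?_⟩
  · intro p
    have : w • ((basisMonomials ℚ).constr ℚ q) + derivative ∘ₗ ((basisMonomials ℚ).constr ℚ q)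
        = LinearMap.id := by
      apply (basisMonomials ℚ).ext
      intro n
      simp only [LinearMap.add_apply, LinearMap.smul_apply, LinearMap.comp_apply,
        Module.Basis.constr_basis, hq1]
      simp [X_pow_eq_monomial]
    exact LinearMap.congr_fun this p
  · intro hw p
    have : (leval 0 : ℚ[X] →ₗ[ℚ] ℚ) ∘ₗ ((basisMonomials ℚ).constr ℚ q) = 0 := by
      apply (basisMonomials ℚ).ext
      intro n
      simp [LinearMap.comp_apply, -coe_basisMonomials, Module.Basis.constr_basis, hq2 n hw,
        leval_apply]
    exact LinearMap.congr_fun this p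

theorem weighted_injective (w : ℚ) (p : ℚ[X]) (h : w • p + derivative p = 0)
    (h0 : w = 0 → p.eval 0 = 0) : p = 0 := by
  by_cases hw : w = 0
  · rw [hw, zero_smul, zero_add] at h
    have := derivative_eq_zero.1 h
    rw [eq_C_of_natDegree_eq_zero this] at h0 ⊢
    have := h0 hw
    simp at this
    simp [this]
  · by_contra hp
    have h1 : derivative p = -(w • p) := by rw [eq_neg_iff_add_eq_zero, add_comm]; exact h
    have h2 := degree_derivative_lt hp
    rw [h1, degree_neg, degree_smul_of_smul_regular p
      ((IsUnit.mk0 w hw).isSMulRegular _)] at h2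
    exact lt_irrefl _ h2

variable (N : ℕ)

/-- An auxiliary differential algebra in which the derivation has a Rota-Baxter right inverse. -/
abbrev Model : Type := MvPowerSeries (Fin N) ℚ[X]

/-- The weight of an exponent. -/
def wt (α : Fin N →₀ ℕ) : ℚ := ∑ i : Fin N, ((i : ℕ) + 1 : ℚ) * α i

variable {N}

theorem wt_add (α β : Fin N →₀ ℕ) : wt N (α + β) = wt N α + wt N β := by
  simp [wt, mul_add, Finset.sum_add_distrib]

theorem wt_eq_zero {α : Fin N →₀ ℕ} : wt N α = 0 ↔ α = 0 := by
  constructor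
  · intro h
    have := (Finset.sum_eq_zero_iff_of_nonneg (fun i _ => by positivity)).1 h
    ext i
    have := this i (Finset.mem_univ _)
    have h2 : ((i : ℕ) + 1 : ℚ) ≠ 0 := by positivity
    simpa [h2] using this
  · rintro rfl; simp [wt]

variable (N)

/-- The derivation of the model. -/
def modelD : Model N →ₗ[ℚ] Model N where
  toFun F := fun α => wt N α • F α + derivative (F α)
  map_add' F G := by
    funext α
    change wt N α • (F α + G α) + derivative (F α + G α) =
      (wt N α • F α + derivative (F α)) + (wt N α • G α + derivative (G α))
    rw [smul_add, derivative_add]; exact add_add_add_comm _ _ _ _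
  map_smul' c F := by
    funext α
    change wt N α • (c • F α) + derivative (c • F α) = c • (wt N α • F α + derivative (F α))
    rw [derivative_smul, smul_add, smul_comm]

theorem modelD_coeff (F : Model N) (α : Fin N →₀ ℕ) :
    MvPowerSeries.coeff α (modelD N F) =
      wt N α • MvPowerSeries.coeff α F + derivative (MvPowerSeries.coeff α F) := rfl

/-- Its right inverse. -/
def modelJ : Model N →ₗ[ℚ] Model N where
  toFun F := fun α => (exists_rightInverse (wt N α)).choose (F α)
  map_add' F G := by
    funext α
    exact map_add _ (F α) (G α)
  map_smul' c F := by
    funext α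
    exact map_smul _ c (F α)

theorem modelJ_coeff (F : Model N) (α : Fin N →₀ ℕ) :
    MvPowerSeries.coeff α (modelJ N F) =
      (exists_rightInverse (wt N α)).choose (MvPowerSeries.coeff α F) := rfl

theorem modelDJ (F : Model N) : modelD N (modelJ N F) = F := by
  ext1 α
  rw [modelD_coeff, modelJ_coeff]
  exact (exists_rightInverse (wt N α)).choose_spec.1 _

theorem modelD_mul (F G : Model N) :
    modelD N (F * G) = modelD N F * G + F * modelD N G := by
  classical
  ext1 α
  rw [modelD_coeff, map_add]
  simp only [MvPowerSeries.coeff_mul, derivative_sum, Finset.smul_sum, derivative_mul]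
  rw [← Finset.sum_add_distrib, ← Finset.sum_add_distrib]
  refine Finset.sum_congr rfl fun x hx => ?_
  rw [← Finset.HasAntidiagonal.mem_antidiagonal.1 hx, wt_add, modelD_coeff, modelD_coeff]
  simp only [smul_eq_C_mul, map_add]
  ring

theorem modelD_eq_zero (F : Model N) (h : modelD N F = 0)
    (h0 : (MvPowerSeries.coeff 0 F).eval 0 = 0) : F = 0 := by
  ext1 α
  rw [map_zero]
  refine weighted_injective (wt N α) _ ?_ ?_
  · rw [← modelD_coeff, h, map_zero]
  · intro h; rw [wt_eq_zero.1 h]; exact h0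

theorem modelJ_eval (F : Model N) : (MvPowerSeries.coeff 0 (modelJ N F)).eval 0 = 0 :=
  (exists_rightInverse (wt N 0)).choose_spec.2 (wt_eq_zero.2 rfl) _

theorem modelJ_mul (F G : Model N) :
    modelJ N F * modelJ N G = modelJ N (F * modelJ N G) + modelJ N (modelJ N F * G) := by
  rw [← sub_eq_zero]
  apply modelD_eq_zero
  · rw [map_sub, map_add, modelDJ, modelDJ, modelD_mul, modelDJ, modelDJ, sub_self]
  · simp only [map_sub, map_add, eval_sub, eval_add, map_mul,
      MvPowerSeries.coeff_zero_eq_constantCoeff]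
    have := modelJ_eval N F
    rw [MvPowerSeries.coeff_zero_eq_constantCoeff] at this
    have h2 := fun F => modelJ_eval N F
    simp only [MvPowerSeries.coeff_zero_eq_constantCoeff] at h2
    simp [h2]

/-- The ideal of series without constant term. -/
def modelIdeal : Ideal (Model N) := RingHom.ker (MvPowerSeries.constantCoeff (R := ℚ[X]))

theorem mem_modelIdeal (F : Model N) : F ∈ modelIdeal N ↔ MvPowerSeries.coeff 0 F = 0 := by
  rw [MvPowerSeries.coeff_zero_eq_constantCoeff]; rfl

/-- The value of `y`. -/
def modelGen : Model N := ∑ i, MvPowerSeries.X i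

theorem modelD_X (i : Fin N) :
    modelD N (MvPowerSeries.X i) = ((i : ℕ) + 1 : ℚ) • MvPowerSeries.X i := by
  classical
  ext1 α
  change _ = ((i : ℕ) + 1 : ℚ) • MvPowerSeries.coeff α (MvPowerSeries.X i : Model N)
  rw [modelD_coeff, MvPowerSeries.coeff_X]
  split_ifs with h
  · subst h
    have : wt N (Finsupp.single i 1) = (i : ℕ) + 1 := by
      simp [wt, Finsupp.single_apply]
    simp [this]
  · simp

theorem modelD_iterate_gen (k : ℕ) :
    (modelD N)^[k] (modelGen N) = ∑ i : Fin N, (((i : ℕ) + 1 : ℚ) ^ k) • MvPowerSeries.X i := by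
  induction k with
  | zero => simp [modelGen]
  | succ k ih =>
    rw [Function.iterate_succ_apply', ih, map_sum]
    refine Finset.sum_congr rfl fun i _ => ?_
    rw [map_smul, modelD_X, smul_smul, pow_succ]

theorem iterated_model_idealTL {p : PolyDY} (hp : p ∈ idealTL) :
    iterated (modelD N) (modelGen N) p = 0 := by
  refine iterated_idealTL (J := modelJ N) _ (modelDJ N) (modelD_mul N) (modelJ_mul N)
    (modelIdeal N) ?_ ?_ ?_ ?_ hp
  · intro F hF
    rw [mem_modelIdeal] at *
    rw [modelD_coeff, hF]; simp
  · intro F hF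
    rw [mem_modelIdeal] at *
    rw [modelJ_coeff, hF, map_zero]
  · rw [mem_modelIdeal, modelGen, map_sum]
    simp
  · intro F hF h
    rw [mem_modelIdeal] at hF
    exact modelD_eq_zero N F h (by rw [hF]; simp)

theorem model_aeval (q : MvPolynomial (Fin N) ℚ) :
    MvPolynomial.aeval (fun i => (MvPowerSeries.X i : Model N)) q =
      ((MvPolynomial.map C q : MvPolynomial (Fin N) ℚ[X]) : Model N) := by
  induction q using MvPolynomial.induction_on with
  | C c =>
    simp only [MvPolynomial.aeval_C, MvPolynomial.map_C, MvPolynomial.coe_C,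
      MvPowerSeries.algebraMap_apply]
    rfl
  | add p q hp hq => simp [hp, hq]
  | mul_X p n hp => simp [hp]

theorem model_separates {q : DiffPoly}
    (h : ∀ N, MvPolynomial.aeval (fun n => (modelD N)^[n] (modelGen N)) q = 0) : q = 0 := by
  apply MvPolynomial.funext
  intro a
  rw [map_zero]
  obtain ⟨N, hN⟩ : ∃ N, ∀ k ∈ q.vars, k < N :=
    ⟨q.vars.sup id + 1, fun k hk => Nat.lt_succ_of_le (Finset.le_sup (f := id) hk)⟩
  let g : DiffPoly →ₐ[ℚ] MvPolynomial (Fin N) ℚ :=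
    MvPolynomial.aeval fun k => ∑ i : Fin N, (((i : ℕ) + 1 : ℚ) ^ k) • MvPolynomial.X i
  have h1 : g q = 0 := by
    have h2 := h N
    have h3 : MvPolynomial.aeval (fun n => (modelD N)^[n] (modelGen N)) q =
        MvPolynomial.aeval (fun i => (MvPowerSeries.X i : Model N)) (g q) := by
      rw [← AlgHom.comp_apply]
      congr 1
      apply MvPolynomial.algHom_ext
      intro k
      simp [g, modelD_iterate_gen]
    rw [h3, model_aeval] at h2
    have h4 : (MvPolynomial.map C (g q) : MvPolynomial (Fin N) ℚ[X]) = 0 := by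
      apply MvPolynomial.coe_injective
      simpa using h2
    exact MvPolynomial.map_injective _ C_injective (by rw [h4, map_zero])
  let V : Matrix (Fin N) (Fin N) ℚ := Matrix.vandermonde fun i => ((i : ℕ) + 1 : ℚ)
  have hV : IsUnit V.det := by
    rw [isUnit_iff_ne_zero]
    apply Matrix.det_vandermonde_ne_zero_iff.2
    intro i j hij
    ext
    simpa using hij
  let c : Fin N → ℚ := Matrix.vecMul (fun k : Fin N => a k) V⁻¹
  have hc : ∀ k : Fin N, ∑ i : Fin N, ((i : ℕ) + 1 : ℚ) ^ (k : ℕ) * c i = a k := by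
    intro k
    have : Matrix.vecMul c V = fun k : Fin N => a k := by
      simp [c, Matrix.vecMul_vecMul, Matrix.nonsing_inv_mul _ hV]
    have := congrFun this k
    simp only [Matrix.vecMul, dotProduct, V, Matrix.vandermonde_apply] at this
    rw [← this]
    exact Finset.sum_congr rfl fun i _ => mul_comm _ _
  have h5 : MvPolynomial.eval c (g q) = 0 := by rw [h1, map_zero]
  have h6 : MvPolynomial.eval c (g q) =
      MvPolynomial.aeval (fun k : ℕ => ∑ i : Fin N, ((i : ℕ) + 1 : ℚ) ^ k * c i) q := by
    change MvPolynomial.aeval c (g q) = _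
    rw [← AlgHom.comp_apply]
    congr 1
    apply MvPolynomial.algHom_ext
    intro k
    simp [g]
  rw [← h5, h6]
  change MvPolynomial.aeval a q = _
  exact MvPolynomial.eval₂Hom_congr' rfl (fun k hk _ => (hc ⟨k, hN k hk⟩).symm) rfl

theorem toDiffPoly_idealTL {p : PolyDY} (hp : p ∈ idealTL) : toDiffPoly p = 0 := by
  apply model_separates
  intro N
  rw [← iterated_eq_aeval _ _ (modelD_mul N)]
  exact iterated_model_idealTL N hp

end model

/-! ### Every element of `ℚ⟨d, y⟩` killed by the generic evaluation lies in `𝓣₋ + 𝓛₋` -/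

section closure

/-- The words ending in `y`. -/
abbrev endsY : Set Word := {w | w.EndsInY}

theorem sh_mem_idealL {x : PolyDJY} (hx : x ∈ idealL) (a : PolyDJY) : sh a x ∈ idealL :=
  Submodule.mem_sInf.2 fun I hI => (hI.1 x (Submodule.mem_sInf.1 hx I hI) a).1

/-- The word `d^b y`. -/
def gWord (b : ℕ) : Word := (-(b : ℤ), [0])

theorem gWord_endsInY (b : ℕ) : (gWord b).EndsInY := by
  simp [gWord, Word.EndsInY, Word.lastExp]

theorem mulD_gWord (b : ℕ) : mulD (word (gWord b)) = word (gWord (b + 1)) := by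
  rw [mulD_word]; simp only [gWord]; congr 2; push_cast; ring

theorem shWord_gWord_zero (v : Word) : shWord (gWord 0) v = mulY (word v) := by
  change shWord (0, 0 :: []) v = _
  rw [shWord_y_left, shWord_one_left]

theorem shWord_gWord_y (b : ℕ) (k : ℤ) (l : List ℤ) :
    shWord (gWord b) (0, k :: l) = mulY (shWord (gWord b) (k, l)) := by
  cases b with
  | zero => rw [shWord_gWord_zero, shWord_gWord_zero, mulY_word, mulY_word, mulY_word]
  | succ b => exact shWord_y_right _ _ (by push_cast; omega) _ _

theorem sh_gWord_mulY (b : ℕ) (x : PolyDJY) :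
    sh (word (gWord b)) (mulY x) = mulY (sh (word (gWord b)) x) := by
  have : sh (word (gWord b)) ∘ₗ mulY = mulY ∘ₗ sh (word (gWord b)) := by
    apply hom_ext_word
    intro w
    simp only [LinearMap.comp_apply]
    rw [mulY_word, sh_word, sh_word, shWord_gWord_y]
  exact LinearMap.congr_fun this x

theorem sh_gWord_zero (x : PolyDJY) : sh (word (gWord 0)) x = mulY x := by
  have : sh (word (gWord 0)) = mulY := by
    apply hom_ext_word
    intro w
    rw [sh_word, shWord_gWord_zero]
  rw [this]

theorem sh_gWord_one (b : ℕ) : sh (word (gWord b)) (word (0, [])) = word (gWord b) := by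
  rw [sh_word]
  cases b with
  | zero => rw [shWord_gWord_zero, mulY_word]; rfl
  | succ b => exact shWord_one_right _ _ (by push_cast; omega)

theorem jPow_endsY (k : ℤ) {x : PolyDJY} (hx : x ∈ Submodule.span ℚ (word '' endsY)) :
    jPow k x ∈ Submodule.span ℚ (word '' endsY) := by
  refine span_map (jPow k) (fun w hw => ?_) hx
  rw [jPow_word]
  obtain ⟨a, l⟩ := w
  refine word_mem ?_
  obtain ⟨h1, h2⟩ := hw
  cases l with
  | nil => exact absurd rfl h1
  | cons c l =>
    refine ⟨h1, ?_⟩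
    simp only [Word.lastExp, List.getLastD_cons] at h2 ⊢
    exact h2

theorem mulY_endsY {x : PolyDJY} (hx : x ∈ Submodule.span ℚ (word '' endsY)) :
    mulY x ∈ Submodule.span ℚ (word '' endsY) := by
  refine span_map mulY (fun w hw => ?_) hx
  rw [mulY_word]
  refine word_mem ⟨by simp, ?_⟩
  simpa only [Word.lastExp, List.getLastD_cons] using hw.2

theorem shWord_gWord_endsY (b : ℕ) (l : List ℤ) : ∀ (k : ℤ), Word.EndsInY (k, l) →
    shWord (gWord b) (k, l) ∈ Submodule.span ℚ (word '' endsY) := by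
  induction b generalizing l with
  | zero =>
    intro k h
    rw [shWord_gWord_zero]
    exact mulY_endsY (word_mem h)
  | succ b ihb =>
    induction l with
    | nil => intro k h; exact absurd rfl h.1
    | cons a l ihl =>
      intro k h
      by_cases hk : k = 0
      · subst hk
        rw [shWord_gWord_y]
        have h2 : Word.lastExp (a, l) = 0 := by
          have := h.2
          simpa only [Word.lastExp, List.getLastD_cons] using this
        cases l with
        | nil =>
          have : a = 0 := h2
          subst this
          rw [← sh_word, sh_gWord_one]
          exact mulY_endsY (word_mem (gWord_endsInY _))
        | cons c l => exact mulY_endsY (ihl a ⟨by simp, h2⟩)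
      · have hneg : (-((b + 1 : ℕ) : ℤ)) < 0 := by push_cast; omega
        have e := shWord_d (-((b + 1 : ℕ) : ℤ)) [0] hneg k (a :: l) hk
        have e2 : ((-((b + 1 : ℕ) : ℤ) + 1, [0]) : Word) = gWord b := by
          simp only [gWord]; congr 1; push_cast; ring
        rw [e2] at e
        rw [gWord, e]
        have hshift : ∀ k', Word.EndsInY (k', a :: l) := fun k' => ⟨by simp, by
          have := h.2
          simpa only [Word.lastExp, List.getLastD_cons] using this⟩
        exact Submodule.sub_mem _ (jPow_endsY _ (ihb _ _ h)) (ihb _ _ (hshift _))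

theorem sh_gWord_endsY (b : ℕ) {x : PolyDJY} (hx : x ∈ Submodule.span ℚ (word '' endsY)) :
    sh (word (gWord b)) x ∈ Submodule.span ℚ (word '' endsY) := by
  refine span_map _ (fun w hw => ?_) hx
  rw [sh_word]
  exact shWord_gWord_endsY b w.2 w.1 hw

/-- Combinations of words ending in `y` all of whose left multiples by `d^k` lie in `𝓛`. -/
def stableL : Submodule ℚ PolyDJY where
  carrier := {x | x ∈ Submodule.span ℚ (word '' endsY) ∧ ∀ k : ℕ, jPow (-(k : ℤ)) x ∈ idealL}
  zero_mem' := ⟨Submodule.zero_mem _, fun k => by rw [map_zero]; exact Submodule.zero_mem _⟩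
  add_mem' := fun ha hb => ⟨Submodule.add_mem _ ha.1 hb.1, fun k => by
    rw [map_add]; exact Submodule.add_mem _ (ha.2 k) (hb.2 k)⟩
  smul_mem' := fun c x hx => ⟨Submodule.smul_mem _ _ hx.1, fun k => by
    rw [map_smul]; exact Submodule.smul_mem _ _ (hx.2 k)⟩

theorem stableL_le {x : PolyDJY} (hx : x ∈ stableL) : x ∈ idealL := by
  have := hx.2 0
  rwa [Nat.cast_zero, neg_zero, jPow_zero] at this

theorem stableL_mulD {x : PolyDJY} (hx : x ∈ stableL) : mulD x ∈ stableL := by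
  refine ⟨jPow_endsY _ hx.1, fun k => ?_⟩
  rw [mulD, ← jPow_add]
  have := hx.2 (k + 1)
  convert this using 2
  push_cast
  congr 1
  ring

/-- The defect of the Leibniz rule. -/
def defect (b : ℕ) : PolyDJY →ₗ[ℚ] PolyDJY :=
  mulD ∘ₗ sh (word (gWord b)) - sh (word (gWord (b + 1))) - sh (word (gWord b)) ∘ₗ mulD

theorem defect_apply (b : ℕ) (x : PolyDJY) : defect b x = mulD (sh (word (gWord b)) x)
    - sh (word (gWord (b + 1))) x - sh (word (gWord b)) (mulD x) := rfl

theorem defect_jPow (b : ℕ) (k : ℤ) {x : PolyDJY}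
    (hx : x ∈ Submodule.span ℚ (word '' endsY)) : jPow k (defect b x) ∈ idealL := by
  refine span_induct (idealL.comap (jPow k ∘ₗ defect b)) (fun w hw => ?_) hx
  refine Submodule.mem_sInf.2 fun I hI => hI.2 ?_
  refine ⟨k, gWord b, w, gWord_endsInY b, hw, ?_⟩
  simp only [LinearMap.comp_apply, defect_apply, mulD_gWord]

theorem defect_mem (b : ℕ) {x : PolyDJY} (hx : x ∈ Submodule.span ℚ (word '' endsY)) :
    defect b x ∈ stableL := by
  refine ⟨?_, fun k => defect_jPow b _ hx⟩
  rw [defect_apply]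
  exact Submodule.sub_mem _ (Submodule.sub_mem _ (jPow_endsY _ (sh_gWord_endsY _ hx))
    (sh_gWord_endsY _ hx)) (sh_gWord_endsY _ (jPow_endsY _ hx))

theorem stableL_sh (b : ℕ) {x : PolyDJY} (hx : x ∈ stableL) :
    sh (word (gWord b)) x ∈ stableL := by
  refine ⟨sh_gWord_endsY b hx.1, fun k => ?_⟩
  induction k generalizing b x with
  | zero =>
    rw [Nat.cast_zero, neg_zero, jPow_zero]
    exact sh_mem_idealL (stableL_le hx) _
  | succ k ih =>
    have e : (-((k + 1 : ℕ) : ℤ)) = -(k : ℤ) + -1 := by push_cast; ring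
    rw [e, jPow_add]
    change jPow _ (mulD _) ∈ _
    have e2 : mulD (sh (word (gWord b)) x) = defect b x + sh (word (gWord (b + 1))) x
        + sh (word (gWord b)) (mulD x) := by rw [defect_apply]; abel
    rw [e2, map_add, map_add]
    exact Submodule.add_mem _ (Submodule.add_mem _ (defect_jPow b _ hx.1) (ih _ hx))
      (ih _ (stableL_mulD hx))

theorem stableL_mulY {x : PolyDJY} (hx : x ∈ stableL) : mulY x ∈ stableL := by
  rw [← sh_gWord_zero]; exact stableL_sh 0 hx

/-- The largest left ideal of `ℚ⟨d, y⟩` inside `𝓣₋ + 𝓛₋`. -/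
def coreIdeal : Ideal PolyDY where
  carrier := {x | ∀ p : PolyDY, p * x ∈ idealTL}
  zero_mem' := fun p => by rw [mul_zero]; exact Submodule.zero_mem _
  add_mem' := fun ha hb p => by rw [mul_add]; exact Submodule.add_mem _ (ha p) (hb p)
  smul_mem' := fun c x hx p => by rw [smul_eq_mul, ← mul_assoc]; exact hx _

theorem mem_coreIdeal {x : PolyDY} : x ∈ coreIdeal ↔ ∀ p : PolyDY, p * x ∈ idealTL := Iff.rfl

theorem coreIdeal_le {x : PolyDY} (hx : x ∈ coreIdeal) : x ∈ idealTL := by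
  simpa using hx 1

theorem mem_coreIdeal_of_stable {x : PolyDY} (hx : inclusion x ∈ stableL) : x ∈ coreIdeal := by
  intro p
  refine Submodule.mem_sup_right ?_
  rw [Submodule.mem_comap, inclusion_mul]
  exact stableL_le (letterAction_mem mulD mulY stableL (fun b => stableL_mulD)
    (fun b => stableL_mulY) p _ hx)

theorem mul_dd_mem (p : PolyDY) : p * dd ∈ coreIdeal := by
  intro q
  rw [← mul_assoc]
  refine Submodule.mem_sup_left ?_
  rw [Submodule.mem_comap, inclusion_mul]
  have h := letterAction_mem mulD mulY
    (Submodule.span ℚ (word '' {w : Word | w.lastExp < 0})) (fun b hb => ?_) (fun b hb => ?_)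
    (q * p) (inclusion dd) ?_
  · refine span_map LinearMap.id (fun w hw => word_mem ?_) h
    exact ne_of_lt hw
  · refine span_map mulD (fun w hw => ?_) hb
    rw [mulD_word]
    refine word_mem ?_
    obtain ⟨a, l⟩ := w
    cases l with
    | nil =>
      change a < 0 at hw
      change -1 + a < 0
      omega
    | cons c l =>
      change Word.lastExp _ < 0 at hw
      change Word.lastExp _ < 0
      simpa only [Word.lastExp, List.getLastD_cons] using hw
  · refine span_map mulY (fun w hw => ?_) hb
    rw [mulY_word]
    refine word_mem ?_
    change Word.lastExp _ < 0 at hw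
    change Word.lastExp _ < 0
    simpa only [Word.lastExp, List.getLastD_cons] using hw
  · rw [inclusion_apply, letterAction_dd, mulD_word]
    exact word_mem (by change (-1 + 0 : ℤ) < 0; norm_num)

/-- The iterated commutators `[d, [d, ⋯ [d, y]]]`. -/
def adY : ℕ → PolyDY
  | 0 => yy
  | b + 1 => dd * adY b - adY b * dd

theorem inclusion_yy_mul (w : PolyDY) : inclusion (yy * w) = mulY (inclusion w) := by
  rw [inclusion_mul, letterAction_yy]

theorem inclusion_dd_mul (w : PolyDY) : inclusion (dd * w) = mulD (inclusion w) := by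
  rw [inclusion_mul, letterAction_dd]

theorem inclusion_one : inclusion 1 = word (0, []) := by simp [inclusion_apply]

theorem inclusion_yy : inclusion yy = word (gWord 0) := by
  rw [inclusion_apply, letterAction_yy, mulY_word]; rfl

theorem inclusion_mul_yy (p : PolyDY) :
    inclusion (p * yy) ∈ Submodule.span ℚ (word '' endsY) := by
  rw [inclusion_mul, inclusion_yy]
  exact letterAction_mem mulD mulY _ (fun b hb => jPow_endsY _ hb) (fun b hb => mulY_endsY hb)
    p _ (word_mem (gWord_endsInY 0))

theorem adY_sh (b : ℕ) (p : PolyDY) :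
    inclusion (adY b * (p * yy)) - sh (word (gWord b)) (inclusion (p * yy)) ∈ stableL := by
  induction b generalizing p with
  | zero =>
    rw [adY, inclusion_yy_mul, sh_gWord_zero, sub_self]; exact Submodule.zero_mem _
  | succ b ih =>
    have h1 := stableL_mulD (ih p)
    have h2 := ih (dd * p)
    have h3 := defect_mem b (inclusion_mul_yy p)
    have e : inclusion (adY (b + 1) * (p * yy)) = mulD (inclusion (adY b * (p * yy)))
        - inclusion (adY b * (dd * p * yy)) := by
      rw [adY, sub_mul, map_sub, mul_assoc, inclusion_dd_mul, mul_assoc (adY b), mul_assoc dd]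
    have e2 : inclusion (dd * p * yy) = mulD (inclusion (p * yy)) := by
      rw [mul_assoc, inclusion_dd_mul]
    rw [e2] at h2
    rw [defect_apply] at h3
    rw [map_sub] at h1
    rw [e]
    convert Submodule.add_mem _ (Submodule.sub_mem _ h1 h2) h3 using 1
    abel

theorem adY_sub_mem (b : ℕ) : ∃ p : PolyDY, adY b - dd ^ b * yy = p * dd := by
  induction b with
  | zero => exact ⟨0, by simp [adY]⟩
  | succ b ih =>
    obtain ⟨p, hp⟩ := ih
    refine ⟨dd * p - adY b, ?_⟩
    rw [adY, sub_mul, mul_assoc dd p, ← hp, pow_succ']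
    noncomm_ring

theorem inclusion_gWord (b : ℕ) : inclusion (dd ^ b * yy) = word (gWord b) := by
  induction b with
  | zero => rw [pow_zero, one_mul, inclusion_yy]
  | succ b ih => rw [pow_succ', mul_assoc, inclusion_dd_mul, ih, mulD_gWord]

theorem exists_decomp (p : PolyDY) :
    ∃ (c : ℚ) (u v : PolyDY), p = algebraMap ℚ PolyDY c + u * yy + v * dd := by
  induction p using PolyDY.induct with
  | h1 c => exact ⟨c, 0, 0, by simp⟩
  | hd => exact ⟨0, 0, 1, by simp⟩
  | hy => exact ⟨0, 1, 0, by simp⟩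
  | hm a b h1 h2 =>
    obtain ⟨c, u, v, rfl⟩ := h1
    obtain ⟨c', u', v', rfl⟩ := h2
    refine ⟨c * c', algebraMap ℚ PolyDY c' * u +
        (algebraMap ℚ PolyDY c + u * yy + v * dd) * u',
      algebraMap ℚ PolyDY c' * v + (algebraMap ℚ PolyDY c + u * yy + v * dd) * v', ?_⟩
    rw [mul_add, mul_add, ← Algebra.commutes c' (algebraMap ℚ PolyDY c + u * yy + v * dd), map_mul,
      Algebra.commutes c (algebraMap ℚ PolyDY c')]
    noncomm_ring
  | ha a b h1 h2 =>
    obtain ⟨c, u, v, rfl⟩ := h1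
    obtain ⟨c', u', v', rfl⟩ := h2
    exact ⟨c + c', u + u', v + v', by rw [map_add, add_mul, add_mul]; abel⟩

theorem commutator_mem (b : ℕ) (w : PolyDY) :
    (yy * adY b - adY b * yy) * w ∈ coreIdeal := by
  obtain ⟨c, u, v, rfl⟩ := exists_decomp w
  rw [mul_add, mul_add]
  refine coreIdeal.add_mem (coreIdeal.add_mem ?_ ?_) ?_
  · rw [← Algebra.commutes]
    refine coreIdeal.mul_mem_left _ ?_
    obtain ⟨p, hp⟩ := adY_sub_mem b
    have h1 : yy * adY b - yy * (dd ^ b * yy) ∈ coreIdeal := by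
      rw [← mul_sub, hp, ← mul_assoc]; exact mul_dd_mem _
    have h2 : adY b * yy - yy * (dd ^ b * yy) ∈ coreIdeal := by
      apply mem_coreIdeal_of_stable
      have := adY_sh b 1
      rw [one_mul] at this
      convert this using 1
      rw [map_sub, inclusion_yy_mul, inclusion_gWord, inclusion_yy]
      have : (word (gWord 0)) = mulY (word (0, [])) := by rw [mulY_word]; rfl
      rw [this, sh_gWord_mulY, sh_gWord_one]
    have := coreIdeal.sub_mem h1 h2
    rwa [sub_sub_sub_cancel_right] at this
  · apply mem_coreIdeal_of_stable
    have h1 := stableL_mulY (adY_sh b u)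
    have h2 := adY_sh b (yy * u)
    rw [mul_assoc yy, inclusion_yy_mul, sh_gWord_mulY] at h2
    rw [map_sub] at h1
    convert Submodule.sub_mem _ h1 h2 using 1
    rw [sub_mul, map_sub, mul_assoc, inclusion_yy_mul, mul_assoc (adY b) yy]
    abel
  · rw [← mul_assoc]; exact mul_dd_mem _

end closure

section kernel

theorem commute_all {E : Type*} [Ring E] (D : E) (M : ℕ → E)
    (hM : ∀ n, M (n + 1) = D * M n - M n * D) (h0 : ∀ b, M 0 * M b = M b * M 0) :
    ∀ a b, M a * M b = M b * M a := by
  intro a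
  induction a with
  | zero => exact h0
  | succ a ih =>
    intro b
    have h1 := ih b
    have h2 := ih (b + 1)
    rw [hM b] at h2
    rw [hM a]
    have e : (D * M a - M a * D) * M b - M b * (D * M a - M a * D) =
        D * (M a * M b - M b * M a) - (M a * M b - M b * M a) * D
          - (M a * (D * M b - M b * D) - (D * M b - M b * D) * M a) := by noncomm_ring
    rw [h1, h2, sub_self, sub_self, mul_zero, zero_mul, sub_zero, sub_zero] at e
    exact sub_eq_zero.1 e

theorem exists_algHom {E : Type*} [Ring E] [Algebra ℚ E] (M : ℕ → E)
    (hM : ∀ a b, M a * M b = M b * M a) :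
    ∃ Θ : DiffPoly →ₐ[ℚ] E, ∀ n, Θ (MvPolynomial.X n) = M n := by
  have hc : IsMulCommutative (Algebra.adjoin ℚ (Set.range M)) :=
    Algebra.isMulCommutative_adjoin ℚ (by
      rintro _ ⟨a, rfl⟩ _ ⟨b, rfl⟩
      exact hM a b)
  let _ : CommRing (Algebra.adjoin ℚ (Set.range M)) :=
    { (inferInstance : Ring (Algebra.adjoin ℚ (Set.range M))) with
      mul_comm := hc.is_comm.comm }
  let M' : ℕ → Algebra.adjoin ℚ (Set.range M) :=
    fun n => ⟨M n, Algebra.subset_adjoin ⟨n, rfl⟩⟩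
  refine ⟨(Algebra.adjoin ℚ (Set.range M)).val.comp (MvPolynomial.aeval M'), fun n => ?_⟩
  simp [M']

theorem mem_idealTL_of_toDiffPoly {p : PolyDY} (hp : toDiffPoly p = 0) : p ∈ idealTL := by
  apply coreIdeal_le
  let Q := PolyDY ⧸ coreIdeal
  let lm : PolyDY →ₐ[ℚ] Module.End ℚ Q := Algebra.lsmul ℚ ℚ Q
  let one : Q := Submodule.Quotient.mk 1
  have hmk : ∀ a x : PolyDY, lm a (Submodule.Quotient.mk x) = Submodule.Quotient.mk (a * x) :=
    fun a x => rfl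
  have hM : ∀ n, lm (adY (n + 1)) = lm dd * lm (adY n) - lm (adY n) * lm dd := by
    intro n
    rw [← map_mul, ← map_mul, ← map_sub]
    rfl
  have h0 : ∀ b, lm (adY 0) * lm (adY b) = lm (adY b) * lm (adY 0) := by
    intro b
    rw [← sub_eq_zero, ← map_mul, ← map_mul, ← map_sub]
    refine LinearMap.ext fun x => ?_
    obtain ⟨x, rfl⟩ := Submodule.Quotient.mk_surjective coreIdeal x
    rw [hmk, LinearMap.zero_apply, Submodule.Quotient.mk_eq_zero]
    exact commutator_mem b x
  obtain ⟨Θ, hΘ⟩ := exists_algHom (fun n => lm (adY n))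
    (commute_all (lm dd) (fun n => lm (adY n)) hM h0)
  have hcomm : ∀ q : DiffPoly, lm dd * Θ q = Θ (dX q) + Θ q * lm dd := by
    intro q
    induction q using MvPolynomial.induction_on with
    | C c =>
      rw [← MvPolynomial.algebraMap_eq, Derivation.map_algebraMap, map_zero, zero_add,
        AlgHom.commutes, Algebra.commutes]
    | add p q hp hq => simp only [map_add, mul_add, add_mul, hp, hq]; abel
    | mul_X p n ih =>
      have hX : lm dd * lm (adY n) = lm (adY (n + 1)) + lm (adY n) * lm dd := by
        rw [adY, map_sub, map_mul, map_mul]; abel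
      rw [Derivation.leibniz, dX_X, map_mul, hΘ, ← mul_assoc, ih, smul_eq_mul, smul_eq_mul,
        map_add, mul_comm (MvPolynomial.X n), map_mul, map_mul, hΘ, hΘ, add_mul, mul_assoc,
        hX]
      noncomm_ring
  have key : ∀ p : PolyDY, ∀ q : DiffPoly, lm p (Θ q one) =
      Θ (letterAction dX.toLinearMap (LinearMap.mulLeft ℚ (MvPolynomial.X 0)) p q) one := by
    intro p
    induction p using PolyDY.induct with
    | h1 c => intro q; simp [Module.algebraMap_end_apply, AlgHom.commutes]
    | hd =>
      intro q
      rw [letterAction_dd]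
      have h := LinearMap.congr_fun (hcomm q) one
      have h0 : lm dd one = 0 := by
        rw [hmk, Submodule.Quotient.mk_eq_zero, mul_one]
        simpa using mul_dd_mem 1
      simp only [Module.End.mul_apply, LinearMap.add_apply, h0, map_zero, add_zero] at h
      exact h
    | hy =>
      intro q
      rw [letterAction_yy, LinearMap.mulLeft_apply, map_mul, hΘ]; rfl
    | hm a b h1 h2 => intro q; rw [map_mul, map_mul, Module.End.mul_apply, h2, h1]; rfl
    | ha a b h1 h2 =>
      intro q
      rw [map_add, map_add, LinearMap.add_apply, h1, h2, LinearMap.add_apply, map_add]; rfl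
  have h := key p 1
  rw [← toDiffPoly_apply, hp, map_zero, map_one, Module.End.one_apply, LinearMap.zero_apply,
    hmk, mul_one, Submodule.Quotient.mk_eq_zero] at h
  exact h

theorem idealTL_eq_ker : idealTL = LinearMap.ker toDiffPoly := by
  ext p
  exact ⟨fun h => toDiffPoly_idealTL h, fun h => mem_idealTL_of_toDiffPoly h⟩

end kernel

/-! ### The coalgebra `(𝓗₋, Δ₀)` -/
section coalgebra
open scoped TensorProduct

/-- The coproduct of `ℚ⟨d, y⟩`: the algebra homomorphism (for concatenation) for which `d` and
`y` are primitive.  On a word it is the sum of `w_S ⊗ w_{Sᶜ}` over all subsets `S` of the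
positions; modulo words ending in `d` this is the usual explicit formula for `Δ₀`. -/
def coproductDY : PolyDY →ₐ[ℚ] PolyDY ⊗[ℚ] PolyDY :=
  FreeAlgebra.lift ℚ fun a => FreeAlgebra.ι ℚ a ⊗ₜ[ℚ] 1 + 1 ⊗ₜ[ℚ] FreeAlgebra.ι ℚ a

/-- The counit of `ℚ⟨d, y⟩`. -/
def counitDY : PolyDY →ₐ[ℚ] ℚ := FreeAlgebra.lift ℚ fun _ => 0

theorem coproductDY_dd : coproductDY dd = dd ⊗ₜ 1 + 1 ⊗ₜ dd := by simp [coproductDY, dd]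
theorem coproductDY_yy : coproductDY yy = yy ⊗ₜ 1 + 1 ⊗ₜ yy := by simp [coproductDY, yy]

/-- The coproduct of `DiffPoly` with primitive variables. -/
def coproductX : DiffPoly →ₐ[ℚ] DiffPoly ⊗[ℚ] DiffPoly :=
  MvPolynomial.aeval fun n => MvPolynomial.X n ⊗ₜ[ℚ] 1 + 1 ⊗ₜ[ℚ] MvPolynomial.X n

theorem coproductX_dX (q : DiffPoly) :
    coproductX (dX q) = (TensorProduct.map dX.toLinearMap (LinearMap.id (R := ℚ)) +
      TensorProduct.map (LinearMap.id (R := ℚ)) dX.toLinearMap :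
      DiffPoly ⊗[ℚ] DiffPoly →ₗ[ℚ] DiffPoly ⊗[ℚ] DiffPoly) (coproductX q) := by
  let T : DiffPoly ⊗[ℚ] DiffPoly →ₗ[ℚ] DiffPoly ⊗[ℚ] DiffPoly :=
    TensorProduct.map dX.toLinearMap LinearMap.id + TensorProduct.map LinearMap.id dX.toLinearMap
  have hT : ∀ a b, T (a ⊗ₜ b) = dX a ⊗ₜ b + a ⊗ₜ dX b := fun a b => rfl
  have hmul : ∀ x y, T (x * y) = T x * y + x * T y := by
    intro x y
    induction x using TensorProduct.induction_on with
    | zero => simp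
    | add x x' h h' => rw [add_mul, map_add, h, h', map_add, add_mul, add_mul]; abel
    | tmul a b =>
      induction y using TensorProduct.induction_on with
      | zero => simp
      | add y y' h h' => rw [mul_add, map_add, h, h', map_add, mul_add, mul_add]; abel
      | tmul c d =>
        simp only [Algebra.TensorProduct.tmul_mul_tmul, hT, Derivation.leibniz, smul_eq_mul,
          add_mul, mul_add, TensorProduct.add_tmul, TensorProduct.tmul_add]
        rw [mul_comm c (dX a), mul_comm d (dX b)]
        abel
  change coproductX (dX q) = T (coproductX q)
  induction q using MvPolynomial.induction_on with
  | C c =>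
    rw [← MvPolynomial.algebraMap_eq, Derivation.map_algebraMap, map_zero, AlgHom.commutes,
      Algebra.algebraMap_eq_smul_one, map_smul, Algebra.TensorProduct.one_def, hT]
    simp
  | add p q hp hq => simp only [map_add, hp, hq]
  | mul_X p n ih =>
    have hX : ∀ n, coproductX (MvPolynomial.X n) =
      MvPolynomial.X n ⊗ₜ[ℚ] 1 + 1 ⊗ₜ[ℚ] MvPolynomial.X n := fun n => by simp [coproductX]
    have hTX : T (coproductX (MvPolynomial.X n)) = coproductX (MvPolynomial.X (n + 1)) := by
      rw [hX, hX, map_add, hT, hT, dX_X, Derivation.map_one_eq_zero]; simp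
    rw [Derivation.leibniz, dX_X, map_mul, hmul, ← ih, hTX, map_add, smul_eq_mul, smul_eq_mul,
      map_mul, map_mul]
    ring

theorem toDiffPoly_coproduct (p : PolyDY) :
    TensorProduct.map toDiffPoly toDiffPoly (coproductDY p) = coproductX (toDiffPoly p) := by
  let act := letterAction dX.toLinearMap (LinearMap.mulLeft ℚ (MvPolynomial.X 0 : DiffPoly))
  let act2 : PolyDY ⊗[ℚ] PolyDY →ₗ[ℚ] Module.End ℚ (DiffPoly ⊗[ℚ] DiffPoly) :=
    TensorProduct.homTensorHomMap (RingHom.id ℚ) DiffPoly DiffPoly DiffPoly DiffPoly ∘ₗ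
      TensorProduct.map act.toLinearMap act.toLinearMap
  have hact2 : ∀ a b, act2 (a ⊗ₜ b) = TensorProduct.map (act a) (act b) := fun a b => rfl
  have hmul : ∀ x y, act2 (x * y) = act2 x * act2 y := by
    intro x y
    induction x using TensorProduct.induction_on with
    | zero => simp
    | add x x' h h' => rw [add_mul, map_add, h, h', map_add, add_mul]
    | tmul a b =>
      induction y using TensorProduct.induction_on with
      | zero => simp
      | add y y' h h' => rw [mul_add, map_add, h, h', map_add, mul_add]
      | tmul c d =>
        rw [Algebra.TensorProduct.tmul_mul_tmul, hact2, hact2, hact2, map_mul, map_mul]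
        exact TensorProduct.map_mul _ _ _ _
  have key : ∀ p : PolyDY, ∀ q : DiffPoly,
      act2 (coproductDY p) (coproductX q) = coproductX (act p q) := by
    intro p
    induction p using PolyDY.induct with
    | h1 c =>
      intro q
      rw [AlgHom.commutes, AlgHom.commutes, Algebra.algebraMap_eq_smul_one,
        Algebra.TensorProduct.one_def, map_smul, hact2, map_one]
      simp [Module.algebraMap_end_apply]
    | hd =>
      intro q
      have : act dd = dX.toLinearMap := letterAction_dd _ _
      rw [coproductDY_dd, map_add, hact2, hact2, map_one, this]
      exact (coproductX_dX q).symm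
    | hy =>
      intro q
      have : act yy = LinearMap.mulLeft ℚ (MvPolynomial.X 0) := letterAction_yy _ _
      rw [coproductDY_yy, map_add, hact2, hact2, map_one, this, LinearMap.mulLeft_apply, map_mul]
      have hX : coproductX (MvPolynomial.X 0) =
        MvPolynomial.X 0 ⊗ₜ[ℚ] 1 + 1 ⊗ₜ[ℚ] MvPolynomial.X 0 := by simp [coproductX]
      rw [hX, LinearMap.add_apply, add_mul]
      congr 1
      · generalize coproductX q = z
        induction z using TensorProduct.induction_on with
        | zero => simp
        | add x x' h h' => rw [map_add, h, h', mul_add]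
        | tmul a b => simp
      · generalize coproductX q = z
        induction z using TensorProduct.induction_on with
        | zero => simp
        | add x x' h h' => rw [map_add, h, h', mul_add]
        | tmul a b => simp
    | hm a b h1 h2 =>
      intro q
      rw [map_mul, hmul, Module.End.mul_apply, h2, h1, map_mul]; rfl
    | ha a b h1 h2 =>
      intro q
      rw [map_add, map_add, LinearMap.add_apply, h1, h2, map_add, LinearMap.add_apply, map_add]
  have h := key p 1
  rw [map_one] at h
  change _ = coproductX (act p 1)
  rw [← h]
  generalize coproductDY p = z
  induction z using TensorProduct.induction_on with
  | zero => simp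
  | add x x' h h' => rw [map_add, h, h', map_add, LinearMap.add_apply]
  | tmul a b => rw [hact2, Algebra.TensorProduct.one_def]; rfl

theorem counitDY_eq (p : PolyDY) : counitDY p = MvPolynomial.constantCoeff (toDiffPoly p) := by
  have hd : ∀ q : DiffPoly, MvPolynomial.constantCoeff (dX q) = 0 := by
    intro q
    induction q using MvPolynomial.induction_on with
    | C c => rw [← MvPolynomial.algebraMap_eq, Derivation.map_algebraMap, map_zero]
    | add p q hp hq => simp [hp, hq]
    | mul_X p n ih => rw [Derivation.leibniz, dX_X]; simp
  have key : ∀ p : PolyDY, ∀ q : DiffPoly,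
      MvPolynomial.constantCoeff (letterAction dX.toLinearMap
        (LinearMap.mulLeft ℚ (MvPolynomial.X 0)) p q) =
      counitDY p * MvPolynomial.constantCoeff q := by
    intro p
    induction p using PolyDY.induct with
    | h1 c => intro q; simp [Module.algebraMap_end_apply]
    | hd =>
      intro q
      rw [letterAction_dd]
      have : counitDY dd = 0 := by simp [counitDY, dd]
      rw [this, zero_mul]; exact hd q
    | hy =>
      intro q
      have : counitDY yy = 0 := by simp [counitDY, yy]
      rw [letterAction_yy, this]; simp
    | hm a b h1 h2 => intro q; rw [map_mul, Module.End.mul_apply, h1, h2, map_mul, mul_assoc]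
    | ha a b h1 h2 =>
      intro q; rw [map_add, LinearMap.add_apply, map_add, h1, h2, map_add, add_mul]
  have := key p 1
  have h1 : MvPolynomial.constantCoeff (1 : DiffPoly) = 1 := map_one _
  rw [h1, mul_one] at this
  rw [← this]; rfl

theorem coproduct_wellDefined :
    idealTL ≤ LinearMap.ker (TensorProduct.map idealTL.mkQ idealTL.mkQ ∘ₗ
      coproductDY.toLinearMap) := by
  intro p hp
  have hinj : Function.Injective (idealTL.liftQ toDiffPoly idealTL_eq_ker.le) := by
    rw [← LinearMap.ker_eq_bot]
    exact Submodule.ker_liftQ_eq_bot _ _ _ idealTL_eq_ker.ge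
  obtain ⟨g, hg⟩ := LinearMap.exists_leftInverse_of_injective _ (LinearMap.ker_eq_bot.2 hinj)
  have h2 : idealTL.mkQ = g ∘ₗ toDiffPoly := by
    ext x
    have := LinearMap.congr_fun hg (idealTL.mkQ x)
    simpa using this.symm
  rw [LinearMap.mem_ker, h2, TensorProduct.map_comp]
  simp only [LinearMap.comp_apply, AlgHom.toLinearMap_apply]
  rw [toDiffPoly_coproduct, toDiffPoly_idealTL hp, map_zero, map_zero]

theorem counit_wellDefined : idealTL ≤ LinearMap.ker counitDY.toLinearMap := by
  intro p hp
  rw [LinearMap.mem_ker, AlgHom.toLinearMap_apply, counitDY_eq, toDiffPoly_idealTL hp, map_zero]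

theorem coproductDY_coassoc (p : PolyDY) :
    TensorProduct.assoc ℚ PolyDY PolyDY PolyDY
      (coproductDY.toLinearMap.rTensor PolyDY (coproductDY p)) =
    coproductDY.toLinearMap.lTensor PolyDY (coproductDY p) := by
  have : ((Algebra.TensorProduct.assoc ℚ ℚ ℚ PolyDY PolyDY PolyDY).toAlgHom.comp
      (Algebra.TensorProduct.map coproductDY (AlgHom.id ℚ PolyDY))).comp coproductDY =
      (Algebra.TensorProduct.map (AlgHom.id ℚ PolyDY) coproductDY).comp coproductDY := by
    apply FreeAlgebra.hom_ext
    funext a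
    simp [coproductDY, TensorProduct.add_tmul, TensorProduct.tmul_add,
      Algebra.TensorProduct.one_def, add_assoc]
  exact AlgHom.congr_fun this p

theorem counitDY_rTensor (p : PolyDY) :
    counitDY.toLinearMap.rTensor PolyDY (coproductDY p) = 1 ⊗ₜ p := by
  have : (Algebra.TensorProduct.map counitDY (AlgHom.id ℚ PolyDY)).comp coproductDY =
      Algebra.TensorProduct.includeRight := by
    apply FreeAlgebra.hom_ext
    funext a
    simp [coproductDY, counitDY]
  exact AlgHom.congr_fun this p

theorem counitDY_lTensor (p : PolyDY) :
    counitDY.toLinearMap.lTensor PolyDY (coproductDY p) = p ⊗ₜ 1 := by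
  have : (Algebra.TensorProduct.map (AlgHom.id ℚ PolyDY) counitDY).comp coproductDY =
      Algebra.TensorProduct.includeLeft := by
    apply FreeAlgebra.hom_ext
    funext a
    simp [coproductDY, counitDY]
  exact AlgHom.congr_fun this p

/-- The coproduct `Δ₀` and the counit of `𝓗₋`, induced from `ℚ⟨d, y⟩`. -/
instance : CoalgebraStruct ℚ HMinus where
  comul := idealTL.liftQ _ coproduct_wellDefined
  counit := idealTL.liftQ _ counit_wellDefined

theorem comul_mk : (Coalgebra.comul (R := ℚ) (A := HMinus)) ∘ₗ idealTL.mkQ =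
    TensorProduct.map idealTL.mkQ idealTL.mkQ ∘ₗ coproductDY.toLinearMap :=
  Submodule.liftQ_mkQ _ _ _

theorem counit_mk : (Coalgebra.counit (R := ℚ) (A := HMinus)) ∘ₗ idealTL.mkQ =
    counitDY.toLinearMap := Submodule.liftQ_mkQ _ _ _

theorem comul_mk_apply (p : PolyDY) : Coalgebra.comul (R := ℚ) (idealTL.mkQ p) =
    TensorProduct.map idealTL.mkQ idealTL.mkQ (coproductDY p) := rfl

theorem counit_mk_apply (p : PolyDY) : Coalgebra.counit (R := ℚ) (idealTL.mkQ p) =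
    counitDY p := rfl

instance : Coalgebra ℚ HMinus where
  coassoc := by
    refine LinearMap.ext fun x => ?_
    obtain ⟨p, rfl⟩ := idealTL.mkQ_surjective x
    have hr : ∀ z : PolyDY ⊗[ℚ] PolyDY, (Coalgebra.comul (R := ℚ) (A := HMinus)).rTensor HMinus
        (TensorProduct.map idealTL.mkQ idealTL.mkQ z) =
        TensorProduct.map (TensorProduct.map idealTL.mkQ idealTL.mkQ) idealTL.mkQ
          (coproductDY.toLinearMap.rTensor PolyDY z) := by
      intro z
      induction z using TensorProduct.induction_on with
      | zero => simp
      | add a b h h' => simp only [map_add, h, h']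
      | tmul a b => rfl
    have hl : ∀ z : PolyDY ⊗[ℚ] PolyDY, (Coalgebra.comul (R := ℚ) (A := HMinus)).lTensor HMinus
        (TensorProduct.map idealTL.mkQ idealTL.mkQ z) =
        TensorProduct.map idealTL.mkQ (TensorProduct.map idealTL.mkQ idealTL.mkQ)
          (coproductDY.toLinearMap.lTensor PolyDY z) := by
      intro z
      induction z using TensorProduct.induction_on with
      | zero => simp
      | add a b h h' => simp only [map_add, h, h']
      | tmul a b => rfl
    simp only [LinearMap.comp_apply, LinearEquiv.coe_coe]
    rw [comul_mk_apply, hr, hl, ← coproductDY_coassoc]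
    exact LinearMap.congr_fun
      (TensorProduct.map_map_comp_assoc_eq idealTL.mkQ idealTL.mkQ idealTL.mkQ).symm _
  rTensor_counit_comp_comul := by
    refine LinearMap.ext fun x => ?_
    obtain ⟨p, rfl⟩ := idealTL.mkQ_surjective x
    have hr : ∀ z : PolyDY ⊗[ℚ] PolyDY, (Coalgebra.counit (R := ℚ) (A := HMinus)).rTensor HMinus
        (TensorProduct.map idealTL.mkQ idealTL.mkQ z) =
        idealTL.mkQ.lTensor ℚ (counitDY.toLinearMap.rTensor PolyDY z) := by
      intro z
      induction z using TensorProduct.induction_on with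
      | zero => simp
      | add a b h h' => simp only [map_add, h, h']
      | tmul a b => rfl
    rw [LinearMap.comp_apply, comul_mk_apply, hr, counitDY_rTensor]
    rfl
  lTensor_counit_comp_comul := by
    refine LinearMap.ext fun x => ?_
    obtain ⟨p, rfl⟩ := idealTL.mkQ_surjective x
    have hl : ∀ z : PolyDY ⊗[ℚ] PolyDY, (Coalgebra.counit (R := ℚ) (A := HMinus)).lTensor HMinus
        (TensorProduct.map idealTL.mkQ idealTL.mkQ z) =
        idealTL.mkQ.rTensor ℚ (counitDY.toLinearMap.lTensor PolyDY z) := by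
      intro z
      induction z using TensorProduct.induction_on with
      | zero => simp
      | add a b h h' => simp only [map_add, h, h']
      | tmul a b => rfl
    rw [LinearMap.comp_apply, comul_mk_apply, hl, counitDY_lTensor]
    rfl

end coalgebra

/-! ### Characters with values in Laurent series -/

/-- The coefficientwise algebra structure, chosen among the available (equal) ones. -/
instance (priority := 2000) laurentAlgebra : Algebra ℚ (LaurentSeries ℚ) :=
  HahnSeries.instAlgebra

/-- The Leibniz rule for the formal derivative of Laurent series. -/
theorem laurent_leibniz (a b : LaurentSeries ℚ) :
    LaurentSeries.derivative ℚ (a * b) =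
      LaurentSeries.derivative ℚ a * b + a * LaurentSeries.derivative ℚ b := by
  let E : LaurentSeries ℚ → LaurentSeries ℚ := fun g =>
    ⟨fun n => n * g.coeff n, g.isPWO_support.mono fun n hn => by
      intro h
      exact hn (by simp [h])⟩
  have hE : ∀ g n, (E g).coeff n = n * g.coeff n := fun g n => rfl
  have hsupp : ∀ g, (E g).support ⊆ g.support := by
    intro g n hn h
    exact hn (by simp [hE, h])
  have hmul : E (a * b) = E a * b + a * E b := by
    ext n
    rw [hE, HahnSeries.coeff_add, HahnSeries.coeff_mul,
      HahnSeries.coeff_mul_left' a.isPWO_support (hsupp a),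
      HahnSeries.coeff_mul_right' b.isPWO_support (hsupp b), ← Finset.sum_add_distrib,
      Finset.mul_sum]
    refine Finset.sum_congr rfl fun x hx => ?_
    rw [hE, hE, ← (Finset.mem_antidiagonal.1 hx).2.2]
    push_cast
    ring
  have hder : ∀ g : LaurentSeries ℚ,
      LaurentSeries.derivative ℚ g = HahnSeries.single (-1 : ℤ) 1 * E g := by
    intro g
    ext n
    have : n = (n + 1) + (-1) := by ring
    conv_rhs => rw [this]
    rw [HahnSeries.coeff_single_mul_add, hE, LaurentSeries.derivative_apply,
      LaurentSeries.hasseDeriv_coeff]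
    simp
  rw [hder, hder, hder, hmul]
  ring

theorem iterated_wellDefined {B : Type*} [CommRing B] [Algebra ℚ B] (D : B →ₗ[ℚ] B) (f : B)
    (hD : ∀ a b, D (a * b) = D a * b + a * D b) : idealTL ≤ LinearMap.ker (iterated D f) := by
  intro p hp
  rw [LinearMap.mem_ker, iterated_eq_aeval D f hD, toDiffPoly_idealTL hp, map_zero]

/-- The map `ϕ` attached to a Laurent series `f`:
`ϕ(d^{k₁} y ⋯ d^{kᵣ} y) = ∂^{k₁}[f ∂^{k₂}[f ⋯ ∂^{kᵣ}[f] ⋯ ]]` and `ϕ(1) = 1`. -/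
def phi (f : LaurentSeries ℚ) : HMinus →ₗ[ℚ] LaurentSeries ℚ :=
  idealTL.liftQ (iterated (LaurentSeries.derivative ℚ) f)
    (iterated_wellDefined _ f laurent_leibniz)

/-- The class in `𝓗₋` of the word `d^{k₁} y ⋯ d^{kᵣ} y`, for the list `[k₁, …, kᵣ]`. -/
def dyWord (k : List ℕ) : HMinus := idealTL.mkQ (k.map fun n => dd ^ n * yy).prod

theorem phi_dyWord_nil (f : LaurentSeries ℚ) : phi f (dyWord []) = 1 := by
  change iterated (LaurentSeries.derivative ℚ) f 1 = 1
  simp [iterated_apply]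

theorem phi_dyWord_cons (f : LaurentSeries ℚ) (k : ℕ) (l : List ℕ) :
    phi f (dyWord (k :: l)) = (LaurentSeries.derivative ℚ)^[k] (f * phi f (dyWord l)) := by
  change iterated (LaurentSeries.derivative ℚ) f ((dd ^ k * yy) * _) = _
  rw [iterated_apply, map_mul, map_mul, map_pow, letterAction_dd, letterAction_yy]
  rw [Module.End.mul_apply, Module.End.mul_apply, Module.End.pow_apply]
  rfl

/-- `(φ₋, φ₊)` is the algebraic Birkhoff decomposition of `φ`, for linear maps from `𝓗₋` to the
Laurent series: `φ₋(1) = 1`, `φ₋` maps the augmentation ideal `ker ε` into `z⁻¹ℚ[z⁻¹]` (hence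
`𝓗₋` into `ℚ[z⁻¹]`), `φ₊` takes its values in `ℚ[[z]]`, and `φ = φ₋^{*-1} * φ₊`, where
`φ₋^{*-1}` is the inverse for the convolution product `α * β = m ∘ (α ⊗ β) ∘ Δ₀`. -/
structure IsBirkhoffDecomposition (φ φm φp : HMinus →ₗ[ℚ] LaurentSeries ℚ) : Prop where
  minus_one : φm (dyWord []) = 1
  minus_polar : ∀ x : HMinus, Coalgebra.counit (R := ℚ) x = 0 →
    ∀ n : ℤ, 0 ≤ n → (φm x).coeff n = 0
  plus_regular : ∀ (x : HMinus) (n : ℤ), n < 0 → (φp x).coeff n = 0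
  factorization : ∃ u : (WithConv (HMinus →ₗ[ℚ] LaurentSeries ℚ))ˣ,
    u.val = WithConv.toConv φm ∧ WithConv.toConv φ = u⁻¹.val * WithConv.toConv φp

/-- `F(k₁, …, kᵣ) = lim_{z → 0} φ₊(d^{kᵣ} y ⋯ d^{k₁} y)`: the constant coefficient of a series
without polar part.  Note the reversed order of the exponents. -/
def limitValue (φp : HMinus →ₗ[ℚ] LaurentSeries ℚ) {r : ℕ} (k : Fin r → ℕ) : ℚ :=
  (φp (dyWord (List.ofFn k).reverse)).coeff 0

/-- The exponential generating function
`∑ F(k₁, …, kᵣ) z₁^{k₁} ⋯ zᵣ^{kᵣ} / (k₁! ⋯ kᵣ!)`, given by its coefficients. -/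
def genFun (φp : HMinus →ₗ[ℚ] LaurentSeries ℚ) (r : ℕ) : MvPowerSeries (Fin r) ℚ :=
  fun k => limitValue φp k / ∏ i, (Nat.factorial (k i) : ℚ)

/-- The part `f_{≥0}` of a Laurent series with nonnegative exponents. -/
def regularPart (f : LaurentSeries ℚ) : PowerSeries ℚ := PowerSeries.mk fun n => f.coeff n

end

end ShuffleRenorm

namespace ShuffleRenorm

/-!
A word in `d` and `y` is read as a differential polynomial in one indeterminate `y`; the derivatives
of `y` are then primitive, and `phi f` is evaluation at `f`. Hence `phi f * phi g = phi (f + g)`. If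
`h` is the polar part of `f` and `g = f - h`, this gives `phi f = phi (-h)⁻¹ * phi g`, a Birkhoff
decomposition. It is unique because the convolution quotient of the minus parts of two
decompositions is `1` plus a map with polar values, and also a quotient of the plus parts, so that
its values are regular; thus it is `1`.

The coefficients of the generating function are therefore values of `phi g`, that is, constant
terms of `D^[kᵣ] (g * D^[kᵣ₋₁] (g * ⋯))`. They are obtained from the product by peeling off its
variables in increasing order: the smallest one, `X i`, occurs in a single factor, as `h (X i + a)`,
and by Taylor's formula the coefficient of `X i ^ n` there is `(D^[n] h) (a) / n!`.
-/

section Convolution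

variable {R C A : Type*} [CommRing R] [AddCommGroup C] [Module R C] [Ring A] [Algebra R A]

theorem convMul_apply_mem [CoalgebraStruct R C] (S : NonUnitalSubalgebra R A)
    {α β : WithConv (C →ₗ[R] A)} (hα : ∀ x, α x ∈ S) (hβ : ∀ x, β x ∈ S) (x : C) :
    (α * β) x ∈ S := by
  rw [(Coalgebra.Repr.arbitrary R x).convMul_apply]
  exact sum_mem fun i _ => mul_mem (hα _) (hβ _)

theorem convOne_apply_mem [Coalgebra R C] (S : Subalgebra R A) (x : C) :
    (1 : WithConv (C →ₗ[R] A)) x ∈ S := by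
  rw [LinearMap.convOne_apply]
  exact S.algebraMap_mem _

theorem eq_and_eq_of_convInv_mul_eq [Coalgebra R C] {N : NonUnitalSubalgebra R A}
    {P : Subalgebra R A} (hNP : Disjoint N.toSubmodule (Subalgebra.toSubmodule P))
    {u v b : (WithConv (C →ₗ[R] A))ˣ} {a : WithConv (C →ₗ[R] A)}
    (hu : ∀ x, (u.val - 1) x ∈ N) (hv : ∀ x, (v⁻¹.val - 1) x ∈ N)
    (ha : ∀ x, a x ∈ P) (hb : ∀ x, b⁻¹.val x ∈ P) (h : u⁻¹.val * a = v⁻¹.val * b.val) :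
    u = v ∧ a = b := by
  have ratio_eq : u.val * v⁻¹.val = a * b⁻¹.val := by
    rw [Units.eq_mul_inv_iff_mul_eq, mul_assoc, ← h, Units.mul_inv_cancel_left]
  have ratio_sub_one : u.val * v⁻¹.val - 1 =
      (u.val - 1) * (v⁻¹.val - 1) + (u.val - 1) + (v⁻¹.val - 1) := by noncomm_ring
  have ratio_eq_one : u.val * v⁻¹.val = 1 := by
    rw [← sub_eq_zero]
    refine WithConv.ofConv_injective (LinearMap.ext fun x => ?_)
    refine Submodule.disjoint_def.1 hNP _ ?_ ?_
    · rw [ratio_sub_one]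
      exact add_mem (add_mem (convMul_apply_mem N hu hv x) (hu x)) (hv x)
    · rw [ratio_eq]
      exact sub_mem (convMul_apply_mem P.toNonUnitalSubalgebra ha hb x) (convOne_apply_mem P x)
  have huv : u = v := Units.ext (Units.mul_inv_eq_one.1 ratio_eq_one)
  exact ⟨huv, (Units.mul_right_inj _).1 (huv ▸ h)⟩

end Convolution

section Characters

variable {B : Type*} [CommRing B] [Algebra ℚ B]

theorem derivation_toLinearMap_mul {R A : Type*} [CommSemiring R] [CommSemiring A] [Algebra R A]
    (D : Derivation R A A) (a b : A) :
    D.toLinearMap (a * b) = D.toLinearMap a * b + a * D.toLinearMap b := by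
  rw [Derivation.coeFn_coe, D.leibniz, smul_eq_mul, smul_eq_mul, mul_comm b, add_comm]

/-- The value at `f` of differential polynomials in one indeterminate, for a derivation `D` of
a commutative `ℚ`-algebra. The indeterminate is the class of `y`, and `d` acts as `D`. -/
noncomputable def diffEval (D : Derivation ℚ B B) (f : B) : HMinus →ₗ[ℚ] B :=
  idealTL.liftQ (iterated D.toLinearMap f)
    (iterated_wellDefined D.toLinearMap f (derivation_toLinearMap_mul D))

theorem diffEval_mkQ (D : Derivation ℚ B B) (f : B) (p : PolyDY) :
    diffEval D f (idealTL.mkQ p) =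
      letterAction D.toLinearMap (LinearMap.mulLeft ℚ f) p 1 := rfl

theorem diffEval_mkQ_eq_aeval (D : Derivation ℚ B B) (f : B) (p : PolyDY) :
    diffEval D f (idealTL.mkQ p) = MvPolynomial.aeval (fun n => D^[n] f) (toDiffPoly p) :=
  iterated_eq_aeval D.toLinearMap f (derivation_toLinearMap_mul D) p

theorem diffEval_dyWord_nil (D : Derivation ℚ B B) (f : B) : diffEval D f (dyWord []) = 1 := by
  simp only [dyWord, diffEval_mkQ, List.map_nil, List.prod_nil, map_one, Module.End.one_apply]

theorem diffEval_dyWord_cons (D : Derivation ℚ B B) (f : B) (k : ℕ) (l : List ℕ) :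
    diffEval D f (dyWord (k :: l)) = D^[k] (f * diffEval D f (dyWord l)) := by
  simp only [dyWord, diffEval_mkQ, List.map_cons, List.prod_cons, map_mul, map_pow,
    letterAction_dd, letterAction_yy, Module.End.mul_apply, Module.End.pow_apply,
    LinearMap.mulLeft_apply, Derivation.coeFn_coe]

theorem diffEval_dyWord (D : Derivation ℚ B B) (f : B) (l : List ℕ) :
    diffEval D f (dyWord l) = l.foldr (fun k q => D^[k] (f * q)) 1 := by
  induction l with
  | nil => exact diffEval_dyWord_nil D f
  | cons k l ih => rw [diffEval_dyWord_cons, ih, List.foldr_cons]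

theorem map_diffEval {B' : Type*} [CommRing B'] [Algebra ℚ B'] {D : Derivation ℚ B B}
    {D' : Derivation ℚ B' B'} (g : B →ₐ[ℚ] B') (hg : Function.Semiconj g D D') (f : B)
    (x : HMinus) : g (diffEval D f x) = diffEval D' (g f) x := by
  obtain ⟨p, rfl⟩ := idealTL.mkQ_surjective x
  simp only [diffEval_mkQ_eq_aeval, MvPolynomial.comp_aeval_apply, (hg.iterate_right _).eq]

theorem counitDY_dd : counitDY dd = 0 := by rw [counitDY, dd, FreeAlgebra.lift_ι_apply]

theorem counitDY_yy : counitDY yy = 0 := by rw [counitDY, yy, FreeAlgebra.lift_ι_apply]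

theorem diffEval_mem_of_counit_eq_zero {D : Derivation ℚ B B} {S : NonUnitalSubalgebra ℚ B}
    (hD : ∀ b ∈ S, D b ∈ S) {f : B} (hf : f ∈ S) {x : HMinus}
    (hx : Coalgebra.counit (R := ℚ) x = 0) : diffEval D f x ∈ S := by
  obtain ⟨p, rfl⟩ := idealTL.mkQ_surjective x
  obtain ⟨c, u, v, rfl⟩ := exists_decomp p
  obtain rfl : c = 0 := by
    simpa only [counit_mk_apply, map_add, map_mul, counitDY_dd, counitDY_yy, mul_zero, add_zero,
      AlgHom.commutes, Algebra.algebraMap_self_apply] using hx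
  have action_mem := letterAction_mem D.toLinearMap (LinearMap.mulLeft ℚ f) S.toSubmodule
    hD (fun b hb => S.mul_mem hf hb) u f hf
  simpa only [diffEval_mkQ, map_zero, zero_add, map_add, map_mul, letterAction_dd,
    letterAction_yy, LinearMap.add_apply, Module.End.mul_apply, LinearMap.mulLeft_apply, mul_one,
    Derivation.coeFn_coe, Derivation.map_one_eq_zero, add_zero,
    NonUnitalSubalgebra.mem_toSubmodule] using action_mem

theorem productMap_aeval_comp_coproductX (v w : ℕ → B) :
    (Algebra.TensorProduct.productMap (MvPolynomial.aeval v) (MvPolynomial.aeval w)).comp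
      coproductX = MvPolynomial.aeval (v + w) :=
  MvPolynomial.algHom_ext fun n => by simp [coproductX]

theorem diffEval_convMul (D : Derivation ℚ B B) (f g : B) :
    WithConv.toConv (diffEval D f) * WithConv.toConv (diffEval D g) =
      WithConv.toConv (diffEval D (f + g)) := by
  let ev (f : B) : DiffPoly →ₐ[ℚ] B := MvPolynomial.aeval fun n => D^[n] f
  have diffEval_comp_mkQ (f : B) :
      diffEval D f ∘ₗ idealTL.mkQ = (ev f).toLinearMap ∘ₗ toDiffPoly :=
    LinearMap.ext (diffEval_mkQ_eq_aeval D f)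
  have ev_add : (fun n => D^[n] (f + g)) = (fun n => D^[n] f) + fun n => D^[n] g :=
    funext fun n => iterate_map_add D n f g
  refine WithConv.ofConv_injective (LinearMap.ext fun x => ?_)
  obtain ⟨p, rfl⟩ := idealTL.mkQ_surjective x
  calc LinearMap.mul' ℚ B (TensorProduct.map (diffEval D f) (diffEval D g)
        (TensorProduct.map idealTL.mkQ idealTL.mkQ (coproductDY p)))
      = LinearMap.mul' ℚ B (TensorProduct.map (ev f).toLinearMap (ev g).toLinearMap
          (coproductX (toDiffPoly p))) := by
        rw [← LinearMap.comp_apply (TensorProduct.map _ _), ← TensorProduct.map_comp,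
          diffEval_comp_mkQ, diffEval_comp_mkQ, TensorProduct.map_comp, LinearMap.comp_apply,
          toDiffPoly_coproduct]
    _ = MvPolynomial.aeval (fun n => D^[n] (f + g)) (toDiffPoly p) := by
        rw [ev_add, ← productMap_aeval_comp_coproductX,
          Algebra.TensorProduct.productMap_eq_comp_map]
        rfl
    _ = diffEval D (f + g) (idealTL.mkQ p) := (diffEval_mkQ_eq_aeval D (f + g) p).symm

theorem toConv_diffEval_zero (D : Derivation ℚ B B) : WithConv.toConv (diffEval D 0) = 1 := by
  refine WithConv.ofConv_injective (LinearMap.ext fun x => ?_)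
  obtain ⟨p, rfl⟩ := idealTL.mkQ_surjective x
  change diffEval D 0 (idealTL.mkQ p) = algebraMap ℚ B (counitDY p)
  simp only [diffEval_mkQ_eq_aeval, counitDY_eq, iterate_map_zero, MvPolynomial.aeval_zero']

/-- `diffEval D f` as a unit for convolution. -/
noncomputable def diffEvalUnit (D : Derivation ℚ B B) (f : B) : (WithConv (HMinus →ₗ[ℚ] B))ˣ where
  val := WithConv.toConv (diffEval D f)
  inv := WithConv.toConv (diffEval D (-f))
  val_inv := by rw [diffEval_convMul, add_neg_cancel, toConv_diffEval_zero]
  inv_val := by rw [diffEval_convMul, neg_add_cancel, toConv_diffEval_zero]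

end Characters

section LaurentSeries

variable {R : Type*} [CommRing R]

theorem coeff_laurentDerivative (f : LaurentSeries R) (n : ℤ) :
    (LaurentSeries.derivative R f).coeff n = (n + 1) * f.coeff (n + 1) := by
  rw [LaurentSeries.derivative_apply, LaurentSeries.hasseDeriv_coeff]
  simp

theorem laurentDerivative_ofPowerSeries (g : PowerSeries R) :
    LaurentSeries.derivative R (HahnSeries.ofPowerSeries ℤ R g) =
      HahnSeries.ofPowerSeries ℤ R (PowerSeries.derivative R g) := by
  ext n
  rw [coeff_laurentDerivative, PowerSeries.coeff_coe, PowerSeries.coeff_coe]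
  rcases lt_trichotomy n (-1) with h | rfl | h
  · rw [if_pos (by omega), if_pos (by omega), mul_zero]
  · simp
  · lift n to ℕ using by omega
    rw [if_neg (by omega), if_neg (by omega), PowerSeries.coeff_derivative, Int.natAbs_natCast,
      show ((n : ℤ) + 1).natAbs = n + 1 by omega]
    push_cast
    ring

variable (R) in
/-- The subalgebra without unit `z⁻¹R[z⁻¹]` of Laurent series. -/
def polar : NonUnitalSubalgebra R (LaurentSeries R) where
  carrier := {f | ∀ n : ℤ, 0 ≤ n → f.coeff n = 0}
  zero_mem' _ _ := rfl
  add_mem' ha hb n hn := by rw [HahnSeries.coeff_add, ha n hn, hb n hn, add_zero]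
  smul_mem' c f hf n hn := by rw [HahnSeries.coeff_smul, hf n hn, smul_zero]
  mul_mem' {f g} hf hg n hn := by
    rw [HahnSeries.coeff_mul]
    refine Finset.sum_eq_zero fun x hx => ?_
    have hx_add := (Finset.mem_antidiagonal.1 hx).2.2
    rcases le_or_gt 0 x.1 with h | h
    · rw [hf _ h, zero_mul]
    · rw [hg x.2 (by omega), mul_zero]

theorem laurentDerivative_mem_polar {f : LaurentSeries R} (hf : f ∈ polar R) :
    LaurentSeries.derivative R f ∈ polar R := fun n hn => by
  rw [coeff_laurentDerivative, hf _ (by omega), mul_zero]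

theorem sub_ofPowerSeries_mem_polar (f : LaurentSeries R) :
    f - HahnSeries.ofPowerSeries ℤ R (PowerSeries.mk fun n => f.coeff n) ∈ polar R :=
  fun n hn => by
    rw [HahnSeries.coeff_sub, PowerSeries.coeff_coe, if_neg hn.not_gt, PowerSeries.coeff_mk,
      Int.natAbs_of_nonneg hn, sub_self]

theorem mem_range_ofPowerSeries_iff {f : LaurentSeries R} :
    f ∈ (HahnSeries.ofPowerSeries ℤ R).range ↔ ∀ n < 0, f.coeff n = 0 := by
  constructor
  · rintro ⟨g, rfl⟩ n hn
    exact (PowerSeries.coeff_coe g n).trans (if_pos hn)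
  · intro hf
    refine ⟨PowerSeries.mk fun n => f.coeff n, HahnSeries.ext (funext fun n => ?_)⟩
    refine (PowerSeries.coeff_coe _ n).trans ?_
    split_ifs with hn
    · exact (hf n hn).symm
    · rw [PowerSeries.coeff_mk, Int.natAbs_of_nonneg (not_lt.1 hn)]

theorem disjoint_polar_range_ofPowerSeriesAlg :
    Disjoint (polar ℚ).toSubmodule
      (Subalgebra.toSubmodule (HahnSeries.ofPowerSeriesAlg (A := ℚ) ℤ ℚ).range) :=
  Submodule.disjoint_def.2 fun f hpolar hregular => by
    ext n
    rcases lt_or_ge n 0 with h | h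
    · exact mem_range_ofPowerSeries_iff.1 hregular n h
    · exact hpolar n h

end LaurentSeries

section Birkhoff

/-- `∂_z` as a derivation of `ℚ((z))`. -/
noncomputable def laurentDerivation : Derivation ℚ (LaurentSeries ℚ) (LaurentSeries ℚ) :=
  Derivation.mk' (LaurentSeries.derivative ℚ) fun a b => by
    rw [laurent_leibniz, smul_eq_mul, smul_eq_mul]
    ring

theorem phi_eq_diffEval (f : LaurentSeries ℚ) : phi f = diffEval laurentDerivation f := rfl

theorem phi_ofPowerSeries (g : PowerSeries ℚ) (x : HMinus) :
    phi (HahnSeries.ofPowerSeries ℤ ℚ g) x =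
      HahnSeries.ofPowerSeries ℤ ℚ (diffEval (PowerSeries.derivative ℚ) g x) := by
  rw [phi_eq_diffEval]
  exact (map_diffEval (D' := laurentDerivation) (HahnSeries.ofPowerSeriesAlg ℤ ℚ)
    (fun g => (laurentDerivative_ofPowerSeries g).symm) g x).symm

theorem phi_ofPowerSeries_mem (g : PowerSeries ℚ) (x : HMinus) :
    phi (HahnSeries.ofPowerSeries ℤ ℚ g) x ∈ (HahnSeries.ofPowerSeriesAlg (A := ℚ) ℤ ℚ).range :=
  ⟨_, (phi_ofPowerSeries g x).symm⟩

theorem phi_mem_polar {f : LaurentSeries ℚ} (hf : f ∈ polar ℚ) {x : HMinus}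
    (hx : Coalgebra.counit (R := ℚ) x = 0) : phi f x ∈ polar ℚ := by
  rw [phi_eq_diffEval]
  exact diffEval_mem_of_counit_eq_zero (fun _ => laurentDerivative_mem_polar) hf hx

theorem toConv_sub_one_mem_polar {φ : HMinus →ₗ[ℚ] LaurentSeries ℚ} (hone : φ (dyWord []) = 1)
    (hpolar : ∀ x, Coalgebra.counit (R := ℚ) x = 0 → φ x ∈ polar ℚ) (x : HMinus) :
    (WithConv.toConv φ - 1) x ∈ polar ℚ := by
  have counit_one : Coalgebra.counit (R := ℚ) (dyWord []) = 1 := map_one counitDY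
  have hmem := hpolar (x - Coalgebra.counit (R := ℚ) x • dyWord []) (by
    rw [map_sub, map_smul, counit_one, smul_eq_mul, mul_one, sub_self])
  rwa [map_sub, map_smul, hone, ← Algebra.algebraMap_eq_smul_one] at hmem

theorem phi_convMul (f g : LaurentSeries ℚ) :
    WithConv.toConv (phi f) * WithConv.toConv (phi g) = WithConv.toConv (phi (f + g)) := by
  simp only [phi_eq_diffEval, diffEval_convMul]

/-- `phi f` as a unit for convolution. -/
noncomputable def phiUnit (f : LaurentSeries ℚ) : (WithConv (HMinus →ₗ[ℚ] LaurentSeries ℚ))ˣ :=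
  diffEvalUnit laurentDerivation f

theorem isBirkhoffDecomposition_phi_add {h : LaurentSeries ℚ} (hh : h ∈ polar ℚ)
    (g : PowerSeries ℚ) :
    IsBirkhoffDecomposition (phi (h + HahnSeries.ofPowerSeries ℤ ℚ g)) (phi (-h))
      (phi (HahnSeries.ofPowerSeries ℤ ℚ g)) where
  minus_one := phi_dyWord_nil _
  minus_polar _ := phi_mem_polar (neg_mem hh)
  plus_regular x := mem_range_ofPowerSeries_iff.1 (phi_ofPowerSeries_mem g x)
  factorization := by
    refine ⟨(phiUnit h)⁻¹, rfl, ?_⟩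
    rw [inv_inv]
    exact (phi_convMul h _).symm

theorem IsBirkhoffDecomposition.eq_phi {h : LaurentSeries ℚ} (hh : h ∈ polar ℚ)
    {g : PowerSeries ℚ} {φm φp : HMinus →ₗ[ℚ] LaurentSeries ℚ}
    (hφ : IsBirkhoffDecomposition (phi (h + HahnSeries.ofPowerSeries ℤ ℚ g)) φm φp) :
    φm = phi (-h) ∧ φp = phi (HahnSeries.ofPowerSeries ℤ ℚ g) := by
  obtain ⟨u, hu, hfactor⟩ := hφ.factorization
  have hm : ∀ x, (u.val - 1) x ∈ polar ℚ :=
    hu ▸ toConv_sub_one_mem_polar hφ.minus_one hφ.minus_polar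
  have hh_inv : ∀ x, ((phiUnit h)⁻¹⁻¹.val - 1) x ∈ polar ℚ :=
    toConv_sub_one_mem_polar (phi_dyWord_nil h) fun _ => phi_mem_polar hh
  have hp : ∀ x, WithConv.toConv φp x ∈ (HahnSeries.ofPowerSeriesAlg (A := ℚ) ℤ ℚ).range :=
    fun x => mem_range_ofPowerSeries_iff.2 (hφ.plus_regular x)
  have hg_inv (x) : (phiUnit (HahnSeries.ofPowerSeries ℤ ℚ g))⁻¹.val x ∈
      (HahnSeries.ofPowerSeriesAlg (A := ℚ) ℤ ℚ).range := by
    have := phi_ofPowerSeries_mem (-g) x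
    rwa [map_neg] at this
  have factorizations_eq : u⁻¹.val * WithConv.toConv φp =
      (phiUnit h)⁻¹⁻¹.val * (phiUnit (HahnSeries.ofPowerSeries ℤ ℚ g)).val :=
    hfactor.symm.trans (phi_convMul h _).symm
  obtain ⟨hum, hup⟩ := eq_and_eq_of_convInv_mul_eq disjoint_polar_range_ofPowerSeriesAlg
    hm hh_inv hp hg_inv factorizations_eq
  exact ⟨WithConv.toConv_injective (hu.symm.trans (congrArg Units.val hum)),
    WithConv.toConv_injective hup⟩

end Birkhoff

section GeneratingFunction

open scoped Nat

variable {σ R : Type*} [CommRing R]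

theorem finsum_eq_finsum_succ {M : Type*} [AddCommMonoid M] {f : ℕ → M} (h : f 0 = 0) :
    ∑ᶠ n, f n = ∑ᶠ n, f (n + 1) := by
  rw [← finsum_mem_univ, ← finsum_mem_range (f := f) Nat.succ_injective]
  refine finsum_mem_inter_support_eq' f _ _ fun n hn => iff_of_true trivial ?_
  exact ⟨n.pred, Nat.succ_pred fun hzero => hn (hzero ▸ h)⟩

theorem coeff_subst_mul {a : MvPowerSeries σ R} (ha : PowerSeries.HasSubst a) (h : PowerSeries R)
    (p : MvPowerSeries σ R) (m : σ →₀ ℕ) :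
    MvPowerSeries.coeff m (h.subst a * p) =
      ∑ᶠ n, PowerSeries.coeff n h * MvPowerSeries.coeff m (a ^ n * p) := by
  classical
  have finite_support (e : (σ →₀ ℕ) × (σ →₀ ℕ)) : (Function.support fun n =>
      PowerSeries.coeff n h * MvPowerSeries.coeff e.1 (a ^ n) * MvPowerSeries.coeff e.2 p).Finite :=
    (PowerSeries.coeff_subst_finite ha h e.1).subset fun n hn => left_ne_zero_of_mul hn
  simp only [MvPowerSeries.coeff_mul, PowerSeries.coeff_subst ha, Finset.mul_sum, ← mul_assoc,
    finsum_sum_comm _ _ fun e _ => finite_support e]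
  refine Finset.sum_congr rfl fun e _ => ?_
  exact finsum_mul' _ _ (PowerSeries.coeff_subst_finite ha h e.1)

theorem pderiv_subst {a : MvPowerSeries σ R} (ha : PowerSeries.HasSubst a) (h : PowerSeries R)
    (i : σ) : MvPowerSeries.pderiv R i (h.subst a) =
      (PowerSeries.derivative R h).subst a * MvPowerSeries.pderiv R i a := by
  ext m
  have coeff_pow (n : ℕ) : MvPowerSeries.coeff (m + Finsupp.single i 1) (a ^ n) * (m i + 1) =
      n * MvPowerSeries.coeff m (a ^ (n - 1) * MvPowerSeries.pderiv R i a) := by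
    rw [← MvPowerSeries.coeff_pderiv, MvPowerSeries.pderiv_pow, mul_assoc, ← nsmul_eq_mul,
      map_nsmul, nsmul_eq_mul]
  rw [coeff_subst_mul ha, MvPowerSeries.coeff_pderiv, PowerSeries.coeff_subst ha,
    finsum_mul' _ _ (PowerSeries.coeff_subst_finite ha h _)]
  simp only [smul_eq_mul, mul_assoc, coeff_pow, PowerSeries.coeff_derivative]
  rw [finsum_eq_finsum_succ (by simp)]
  simp only [Nat.cast_succ, Nat.add_sub_cancel]

theorem X_dvd_subst_sub_subst {a b : MvPowerSeries σ R} (ha : PowerSeries.HasSubst a)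
    (hb : PowerSeries.HasSubst b) {i : σ} (hab : MvPowerSeries.X i ∣ a - b) (h : PowerSeries R) :
    MvPowerSeries.X i ∣ h.subst a - h.subst b := by
  refine MvPowerSeries.X_dvd_iff.2 fun m hm => ?_
  rw [map_sub, PowerSeries.coeff_subst ha, PowerSeries.coeff_subst hb, sub_eq_zero]
  refine finsum_congr fun n => ?_
  have := MvPowerSeries.X_dvd_iff.1 (hab.trans (sub_dvd_pow_sub_pow a b n)) m hm
  rw [sub_eq_zero.1 ((map_sub _ _ _).symm.trans this)]

theorem coeff_iterate_pderiv (i : σ) (n : ℕ) (F : MvPowerSeries σ R) (m : σ →₀ ℕ) :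
    MvPowerSeries.coeff m ((MvPowerSeries.pderiv R i)^[n] F) =
      (m i + 1).ascFactorial n * MvPowerSeries.coeff (m + Finsupp.single i n) F := by
  induction n generalizing F with
  | zero => simp
  | succ n ih =>
    rw [Function.iterate_succ_apply, ih, MvPowerSeries.coeff_pderiv, add_assoc,
      ← Finsupp.single_add, Nat.ascFactorial_succ, Finsupp.add_apply, Finsupp.single_eq_same]
    push_cast
    ring

theorem iterate_pderiv_subst_mul {a Q : MvPowerSeries σ R} (ha : PowerSeries.HasSubst a) {i : σ}
    (ha_deriv : MvPowerSeries.pderiv R i a = 1) (hQ : MvPowerSeries.pderiv R i Q = 0)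
    (n : ℕ) (h : PowerSeries R) : (MvPowerSeries.pderiv R i)^[n] (h.subst a * Q) =
      ((PowerSeries.derivative R)^[n] h).subst a * Q := by
  have semiconj : Function.Semiconj (fun h : PowerSeries R => h.subst a * Q)
      (PowerSeries.derivative R) (MvPowerSeries.pderiv R i) := fun h => by
    rw [Derivation.leibniz, hQ, smul_zero, zero_add, pderiv_subst ha, ha_deriv, mul_one,
      smul_eq_mul, mul_comm]
  exact ((semiconj.iterate_right n).eq h).symm

theorem coeff_subst_X_add_mul {a Q : MvPowerSeries σ R} (ha : PowerSeries.HasSubst a) {i : σ}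
    (ha_deriv : MvPowerSeries.pderiv R i a = 0) (hQ : MvPowerSeries.pderiv R i Q = 0)
    (h : PowerSeries R) {m : σ →₀ ℕ} (hm : m i = 0) (n : ℕ) :
    MvPowerSeries.coeff (m + Finsupp.single i n) (h.subst (MvPowerSeries.X i + a) * Q) * n ! =
      MvPowerSeries.coeff m (((PowerSeries.derivative R)^[n] h).subst a * Q) := by
  have hXa : PowerSeries.HasSubst (MvPowerSeries.X i + a) :=
    (PowerSeries.HasSubst.X i).add ha
  have hXa_deriv : MvPowerSeries.pderiv R i (MvPowerSeries.X i + a) = 1 := by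
    rw [map_add, MvPowerSeries.pderiv_X_self, ha_deriv, add_zero]
  have X_dvd : MvPowerSeries.X i ∣ ((PowerSeries.derivative R)^[n] h).subst (MvPowerSeries.X i + a)
      * Q - ((PowerSeries.derivative R)^[n] h).subst a * Q := by
    rw [← sub_mul]
    exact (X_dvd_subst_sub_subst hXa ha (by rw [add_sub_cancel_right]) _).mul_right Q
  have coeff_eq := MvPowerSeries.X_dvd_iff.1 X_dvd m hm
  rw [map_sub, sub_eq_zero, ← iterate_pderiv_subst_mul hXa hXa_deriv hQ, coeff_iterate_pderiv,
    hm, zero_add, Nat.one_ascFactorial] at coeff_eq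
  rw [mul_comm, coeff_eq]

theorem hasSubst_sum_X (s : Finset σ) :
    PowerSeries.HasSubst (∑ j ∈ s, MvPowerSeries.X j : MvPowerSeries σ R) :=
  PowerSeries.HasSubst.of_constantCoeff_zero <| by
    simp only [map_sum, MvPowerSeries.constantCoeff_X, Finset.sum_const_zero]

theorem pderiv_sum_X_of_notMem {i : σ} {s : Finset σ} (hi : i ∉ s) :
    MvPowerSeries.pderiv R i (∑ j ∈ s, MvPowerSeries.X j) = 0 := by
  rw [map_sum]
  exact Finset.sum_eq_zero fun j hj =>
    MvPowerSeries.pderiv_X_of_ne (ne_of_mem_of_not_mem hj hi)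

theorem pderiv_prod_subst_sum_X {ι : Type*} {i : σ} {t : Finset ι} {s : ι → Finset σ}
    (hi : ∀ j ∈ t, i ∉ s j) (g : PowerSeries R) :
    MvPowerSeries.pderiv R i (∏ j ∈ t, g.subst (∑ l ∈ s j, MvPowerSeries.X l)) = 0 := by
  refine Finset.prod_induction _ (MvPowerSeries.pderiv R i · = 0)
    (fun a b ha hb => ?_) MvPowerSeries.pderiv_one fun j hj => ?_
  · rw [Derivation.leibniz, ha, hb, smul_zero, smul_zero, add_zero]
  · rw [pderiv_subst (hasSubst_sum_X _), pderiv_sum_X_of_notMem (hi j hj), mul_zero]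

theorem prod_insert_filter_le {M : Type*} [CommMonoid M] [LinearOrder σ] {i : σ} {s : Finset σ}
    (hi : ∀ j ∈ s, i < j) (F : Finset σ → M) :
    ∏ l ∈ insert i s, F {j ∈ insert i s | l ≤ j} =
      F (insert i s) * ∏ l ∈ s, F {j ∈ s | l ≤ j} := by
  rw [Finset.prod_insert fun h => (hi i h).false, Finset.filter_true_of_mem fun j hj =>
    (Finset.mem_insert.1 hj).elim (fun h => h.ge) fun h => (hi j h).le]
  refine congrArg _ (Finset.prod_congr rfl fun l hl => ?_)
  rw [Finset.filter_insert, if_neg (hi l hl).not_ge]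

theorem coeff_subst_sum_mul_prod [LinearOrder σ] (g h : PowerSeries R) (k : σ → ℕ)
    (s : Finset σ) :
    MvPowerSeries.coeff (∑ i ∈ s, Finsupp.single i (k i))
        (h.subst (∑ j ∈ s, MvPowerSeries.X j : MvPowerSeries σ R) *
          ∏ i ∈ s, g.subst (∑ j ∈ s with i ≤ j, MvPowerSeries.X j : MvPowerSeries σ R)) *
      ∏ i ∈ s, ((k i)! : R) =
    PowerSeries.constantCoeff
      ((s.sort (· ≤ ·)).foldl (fun q i => (PowerSeries.derivative R)^[k i] (g * q)) h) := by
  induction s using Finset.induction_on_min generalizing h with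
  | empty => simp [PowerSeries.subst_zero_eq_C_constantCoeff]
  | insert i s hmin ih =>
    have hi : i ∉ s := fun h => (hmin i h).false
    have peel : h.subst (∑ j ∈ insert i s, MvPowerSeries.X j : MvPowerSeries σ R) *
        ∏ l ∈ insert i s,
          g.subst (∑ j ∈ insert i s with l ≤ j, MvPowerSeries.X j : MvPowerSeries σ R) =
        (g * h).subst (MvPowerSeries.X i + ∑ j ∈ s, MvPowerSeries.X j : MvPowerSeries σ R) *
          ∏ l ∈ s, g.subst (∑ j ∈ s with l ≤ j, MvPowerSeries.X j : MvPowerSeries σ R) := by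
      rw [prod_insert_filter_le hmin fun t => g.subst (∑ j ∈ t, MvPowerSeries.X j),
        Finset.sum_insert hi, ← mul_assoc, mul_comm (h.subst _),
        PowerSeries.subst_mul ((PowerSeries.HasSubst.X i).add (hasSubst_sum_X s))]
    have exponent_apply : (∑ j ∈ s, Finsupp.single j (k j)) i = 0 := by
      rw [Finsupp.finsetSum_apply]
      exact Finset.sum_eq_zero fun j hj => Finsupp.single_eq_of_ne (ne_of_mem_of_not_mem hj hi).symm
    rw [peel, Finset.sum_insert hi, add_comm, Finset.prod_insert hi, ← mul_assoc,
      coeff_subst_X_add_mul (hasSubst_sum_X s) (pderiv_sum_X_of_notMem hi)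
        (pderiv_prod_subst_sum_X (fun l _ h => hi (Finset.mem_of_mem_filter _ h)) g) _
        exponent_apply,
      ih, Finset.sort_insert _ (fun j hj => (hmin j hj).le) hi, List.foldl_cons]

theorem limitValue_phi_ofPowerSeries (g : PowerSeries ℚ) {r : ℕ} (k : Fin r →₀ ℕ) :
    limitValue (phi (HahnSeries.ofPowerSeries ℤ ℚ g)) k = PowerSeries.constantCoeff
      ((List.finRange r).foldl (fun q i => (PowerSeries.derivative ℚ)^[k i] (g * q)) 1) := by
  rw [limitValue, phi_ofPowerSeries, diffEval_dyWord, List.foldr_reverse, List.ofFn_eq_map,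
    List.foldl_map, PowerSeries.coeff_coe, if_neg (lt_irrefl _), Int.natAbs_zero,
    PowerSeries.coeff_zero_eq_constantCoeff_apply]

theorem genFun_phi_ofPowerSeries (g : PowerSeries ℚ) (r : ℕ) :
    genFun (phi (HahnSeries.ofPowerSeries ℤ ℚ g)) r = ∏ i : Fin r,
      g.subst (∑ j ∈ Finset.Ici i, MvPowerSeries.X j : MvPowerSeries (Fin r) ℚ) := by
  ext k
  have one_subst : (1 : PowerSeries ℚ).subst
      (∑ j, MvPowerSeries.X j : MvPowerSeries (Fin r) ℚ) = 1 := by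
    rw [← PowerSeries.coe_substAlgHom (hasSubst_sum_X _), map_one]
  have coeff_prod := coeff_subst_sum_mul_prod g 1 k (Finset.univ : Finset (Fin r))
  rw [one_subst, one_mul, Finsupp.univ_sum_single, Fin.sort_univ,
    ← limitValue_phi_ofPowerSeries] at coeff_prod
  have factorials_ne_zero : ∏ i, ((k i).factorial : ℚ) ≠ 0 :=
    Finset.prod_ne_zero_iff.2 fun i _ => Nat.cast_ne_zero.2 (k i).factorial_ne_zero
  simp only [Finset.filter_le_eq_Ici] at coeff_prod
  exact (div_eq_iff factorials_ne_zero).2 coeff_prod.symm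

end GeneratingFunction

end ShuffleRenorm

theorem mainTheorem7 (f : LaurentSeries ℚ) :
    (∃! p : (ShuffleRenorm.HMinus →ₗ[ℚ] LaurentSeries ℚ) ×
        (ShuffleRenorm.HMinus →ₗ[ℚ] LaurentSeries ℚ),
      ShuffleRenorm.IsBirkhoffDecomposition (ShuffleRenorm.phi f) p.1 p.2) ∧
    ∀ φm φp : ShuffleRenorm.HMinus →ₗ[ℚ] LaurentSeries ℚ,
      ShuffleRenorm.IsBirkhoffDecomposition (ShuffleRenorm.phi f) φm φp →
      ∀ r : ℕ, 1 ≤ r →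
        ShuffleRenorm.genFun φp r =
          ∏ i : Fin r, (ShuffleRenorm.regularPart f).subst
            (∑ j ∈ Finset.Ici i, (MvPowerSeries.X j : MvPowerSeries (Fin r) ℚ)) := by
  obtain ⟨h, hh, hf⟩ : ∃ h ∈ ShuffleRenorm.polar ℚ,
      f = h + HahnSeries.ofPowerSeries ℤ ℚ (ShuffleRenorm.regularPart f) :=
    ⟨_, ShuffleRenorm.sub_ofPowerSeries_mem_polar f, (sub_add_cancel f _).symm⟩
  generalize ShuffleRenorm.regularPart f = g at hf ⊢
  subst hf
  refine ⟨⟨(_, _), ShuffleRenorm.isBirkhoffDecomposition_phi_add hh g, fun p hp => ?_⟩, ?_⟩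
  · exact Prod.ext_iff.2 (hp.eq_phi hh)
  · intro φm φp hφ r _
    rw [(hφ.eq_phi hh).2, ShuffleRenorm.genFun_phi_ofPowerSeries]
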